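/- **Setting.** Let $n\ge 1$ and let $\Omega\subseteq\mathbb R^n$ be nonempty and open (an open interval if $n=1$). Inner products are linear in the second argument. Let $a:\Omega\to\mathbb C^{n\times n}$ be Lebesgue measurable, and suppose there are constants $0<a_1\le a_2<\infty$ such that, for a.e. $x\in\Omega$ and all $\xi,\zeta\in\mathbb C^n$, $$a_1\|\xi\|^2\le \operatorname{Re}(\xi,a(x)\xi)_{\mathbb C^n},\qquad |(\zeta,a(x)\xi)_{\mathbb C^n}|\le a_2\|\xi\|\,\|\zeta\|.$$ Let $\mathcal W(\Omega)$ be a closed subspace of the Sobolev space $W^{1,2}(\Omega)$ with $C_0^\infty(\Omega)\subset\mathcal W(\Omega)$. Let $L_{a,\mathcal W(\Omega)}$ be the m-accretive operator in $L^2(\Omega)$ associated with the closed form $$\mathfrak q_{a,\mathcal W(\Omega)}(f,g)=\int_\Omega (\nabla f(x),a(x)\nabla g(x))_{\mathbb C^n}\,d^nx,\qquad f,g\in\mathcal W(\Omega);$$ here the operator associated with a form $\mathfrak q$ maps $u\in\operatorname{dom}(\mathfrak q)$ to $h\in L^2(\Omega)$ exactly when $\mathfrak q(w,u)=(w,h)_{L^2(\Omega)}$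 for all $w\in\operatorname{dom}(\mathfrak q)$. Put $-\Delta_{\mathcal W(\Omega)}:=L_{I_n,\mathcal W(\Omega)}$. Let $V:\Omega\to\mathbb C$ be Lebesgue measurable, put $v=|V|^{1/2}$, and assume $\mathcal W(\Omega)\subseteq\operatorname{dom}(v)=\{f\in L^2(\Omega): vf\in L^2(\Omega)\}$. Let $\mathfrak q_V(f,g)=(vf,e^{i\arg V}vg)_{L^2(\Omega)}$ for $f,g\in\operatorname{dom}(v)$, and let the form sum $L_{a,\mathcal W(\Omega)}+_{\mathfrak q}V$ be the operator associated with $\mathfrak q_{a,\mathcal W(\Omega)}+\mathfrak q_V$ on $\mathcal W(\Omega)$. An operator $T$ is m-accretive if $(T+\zeta I)^{-1}$ is a bounded, everywhere defined operator with norm at most $(\operatorname{Re}\zeta)^{-1}$ whenever $\operatorname{Re}\zeta>0$. It is m-sectorial if it is closed and densely defined, $T+tI$ is m-accretive for some $t\in\mathbb R$, and its numerical range lies in a sector $\{\zeta:|\arg(\zeta-\gamma)|\le\theta\}$ with $\gamma\in\mathbb R$ and $\theta\in[0,\pi/2)$. For an m-accretive $T$, $T^{1/2}$ is its m-accretive square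 root, that is, the closure of $x\mapsto\pi^{-1}\int_0^\infty s^{-1/2}(T+sI)^{-1}Tx\,ds$, $x\in\operatorname{dom}(T)$. For an m-sectorial $T$, $\operatorname{dom}(T^{1/2})$ means $\operatorname{dom}((T+tI)^{1/2})$, and $\operatorname{dom}((T^*)^{1/2})$ means $\operatorname{dom}((T^*+tI)^{1/2})$, for any $t\in\mathbb R$ for which $T+tI$ is m-accretive. **Theorem 3.6.** Assume $$\operatorname{dom}\big(L_{a,\mathcal W(\Omega)}^{1/2}\big)=\operatorname{dom}\big((L_{a,\mathcal W(\Omega)}^*)^{1/2}\big)=\mathcal W(\Omega),$$ and that there are constants $M>0$, $\beta>0$, $\varepsilon_0>0$ such that, for all $0<\varepsilon<\varepsilon_0$ and all $f\in\mathcal W(\Omega)$, $$\||V|^{1/2}f\|_{L^2(\Omega)}^2\le\varepsilon\,\|(-\Delta_{\mathcal W(\Omega)})^{1/2}f\|_{L^2(\Omega)}^2+M\varepsilon^{-\beta}\|f\|_{L^2(\Omega)}^2 .$$ Then: (i) $V$ is infinitesimally form bounded with respect to $L_{a,\mathcal W(\Omega)}$: for every $\alpha>0$ there is $\eta\ge0$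 with $|\mathfrak q_V(f,f)|\le\alpha|\mathfrak q_{a,\mathcal W(\Omega)}(f,f)|+\eta\|f\|_{L^2(\Omega)}^2$ for all $f\in\mathcal W(\Omega)$. Moreover, for all $f\in\mathcal W(\Omega)$ and $0<\varepsilon<a_1^{-1}\varepsilon_0$, $$\||V|^{1/2}f\|_{L^2(\Omega)}^2\le\varepsilon\operatorname{Re}[\mathfrak q_{a,\mathcal W(\Omega)}(f,f)]+Ma_1^{-\beta}\varepsilon^{-\beta}\|f\|_{L^2(\Omega)}^2 .$$ (ii) The form sum $L_{a,\mathcal W(\Omega)}+_{\mathfrak q}V$ is m-sectorial, and $$\operatorname{dom}\big((L_{a,\mathcal W(\Omega)}+_{\mathfrak q}V)^{1/2}\big)=\operatorname{dom}\big(((L_{a,\mathcal W(\Omega)}+_{\mathfrak q}V)^*)^{1/2}\big)=\operatorname{dom}\big(L_{a,\mathcal W(\Omega)}^{1/2}\big)=\operatorname{dom}\big((L_{a,\mathcal W(\Omega)}^*)^{1/2}\big)=\mathcal W(\Omega).$$ -/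

import Mathlib

open MeasureTheory Set Topology
open scoped ContDiff InnerProductSpace LinearPMap

noncomputable section

/-! ### Unbounded operators in a complex Hilbert space -/

section Operators

variable {H : Type*} [NormedAddCommGroup H] [InnerProductSpace ℂ H]

/-- The operator `T + ζ I`, with the domain of `T`. -/
def addScalar (T : H →ₗ.[ℂ] H) (ζ : ℂ) : H →ₗ.[ℂ] H :=
  (ζ • (LinearMap.id : H →ₗ[ℂ] H)) +ᵥ T

/-- The bounded operator `R` is the two-sided inverse `(T + ζ I)⁻¹`. -/
def IsInverseShift (T : H →ₗ.[ℂ] H) (ζ : ℂ) (R : H →L[ℂ] H) : Prop :=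
  (∀ y : H, ∃ h : R y ∈ T.domain, T ⟨R y, h⟩ + ζ • R y = y) ∧
    ∀ x : T.domain, R (T x + ζ • (x : H)) = x

open Classical in
/-- `(T + ζ I)⁻¹` as a bounded operator on `H` (zero if there is no bounded inverse). -/
def inverseShift (T : H →ₗ.[ℂ] H) (ζ : ℂ) : H →L[ℂ] H :=
  if h : ∃ R : H →L[ℂ] H, IsInverseShift T ζ R then h.choose else 0

/-- `T` is m-accretive: for `Re ζ > 0`, `(T + ζ I)⁻¹` is a bounded operator on the whole space
with norm at most `(Re ζ)⁻¹`. -/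
def IsMAccretive (T : H →ₗ.[ℂ] H) : Prop :=
  ∀ ζ : ℂ, 0 < ζ.re → ∃ R : H →L[ℂ] H, IsInverseShift T ζ R ∧ ‖R‖ ≤ (ζ.re)⁻¹

/-- `T` is m-sectorial: closed, densely defined, quasi-m-accretive, and with numerical range in a
sector `{ζ | |arg (ζ - γ)| ≤ θ}` for some `γ ∈ ℝ` and `θ ∈ [0, π/2)`. -/
def IsMSectorial (T : H →ₗ.[ℂ] H) : Prop :=
  T.IsClosed ∧ Dense (T.domain : Set H) ∧
    (∃ t : ℝ, IsMAccretive (addScalar T t)) ∧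
    ∃ γ θ : ℝ, 0 ≤ θ ∧ θ < Real.pi / 2 ∧
      ∀ x : T.domain, ‖(x : H)‖ = 1 → |Complex.arg (⟪(x : H), T x⟫_ℂ - (γ : ℂ))| ≤ θ

/-- The integrand `s ^ (-1/2) (T + s I)⁻¹ T x` in the Balakrishnan formula. -/
def sqrtIntegrand (T : H →ₗ.[ℂ] H) (x : T.domain) (s : ℝ) : H :=
  s ^ (-(1 / 2) : ℝ) • inverseShift T (s : ℂ) (T x)

/-- The graph of `x ↦ π⁻¹ ∫₀^∞ s ^ (-1/2) (T + s I)⁻¹ T x ds` on those `x` in the domain of `T`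
for which the integral converges absolutely (all of them, if `T` is m-accretive). -/
def sqrtPreGraph (T : H →ₗ.[ℂ] H) : Submodule ℂ (H × H) where
  carrier := {p | ∃ x : T.domain, (x : H) = p.1 ∧ IntegrableOn (sqrtIntegrand T x) (Ioi 0) ∧
    p.2 = Real.pi⁻¹ • ∫ s in Ioi (0 : ℝ), sqrtIntegrand T x s}
  zero_mem' := by
    have h : sqrtIntegrand T 0 = fun _ => 0 := by
      funext s
      simp [sqrtIntegrand]
    exact ⟨0, rfl, by simp [h], by simp [h]⟩
  add_mem' := by
    rintro p q ⟨x, hx, hxi, hxv⟩ ⟨y, hy, hyi, hyv⟩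
    have h : sqrtIntegrand T (x + y) = fun s => sqrtIntegrand T x s + sqrtIntegrand T y s := by
      funext s
      simp [sqrtIntegrand, LinearPMap.map_add]
    refine ⟨x + y, by simp [hx, hy], ?_, ?_⟩
    · rw [h]
      exact hxi.add hyi
    · rw [h, integral_add hxi hyi, smul_add, Prod.snd_add, hxv, hyv]
  smul_mem' := by
    rintro c p ⟨x, hx, hxi, hxv⟩
    have h : sqrtIntegrand T (c • x) = fun s => c • sqrtIntegrand T x s := by
      funext s
      simp only [sqrtIntegrand, LinearPMap.map_smul, map_smul]
      rw [smul_comm]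
    refine ⟨c • x, by simp [hx], ?_, ?_⟩
    · rw [h]
      exact hxi.smul c
    · rw [h, integral_smul, Prod.smul_snd, hxv, smul_comm]

/-- The square root `T^{1/2}` of an m-accretive operator `T`: the closure of the operator
`x ↦ π⁻¹ ∫₀^∞ s ^ (-1/2) (T + s I)⁻¹ T x ds` on the domain of `T`. -/
def sqrtOp (T : H →ₗ.[ℂ] H) : H →ₗ.[ℂ] H :=
  (sqrtPreGraph T).topologicalClosure.toLinearPMap

end Operators

/-! ### Sesquilinear forms -/

/-- A sesquilinear form in `H` (antilinear in the first argument) with its domain. -/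
structure SesqForm (H : Type*) [NormedAddCommGroup H] [InnerProductSpace ℂ H] where
  /-- The domain of the form. -/
  domain : Submodule ℂ H
  /-- The values of the form. -/
  form : domain →ₗ⋆[ℂ] domain →ₗ[ℂ] ℂ

namespace SesqForm

variable {H : Type*} [NormedAddCommGroup H] [InnerProductSpace ℂ H]

/-- The sum of two forms, on the intersection of their domains. -/
def sum (p q : SesqForm H) : SesqForm H where
  domain := p.domain ⊓ q.domain
  form := LinearMap.mk₂'ₛₗ (starRingEnd ℂ) (RingHom.id ℂ)
    (fun f g => p.form (Submodule.inclusion inf_le_left f) (Submodule.inclusion inf_le_left g) +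
      q.form (Submodule.inclusion inf_le_right f) (Submodule.inclusion inf_le_right g))
    (fun f f' g => by simp only [map_add, LinearMap.add_apply]; ring)
    (fun c f g => by simp only [map_smul, map_smulₛₗ, LinearMap.smul_apply, smul_add])
    (fun f g g' => by simp only [map_add]; ring)
    (fun c f g => by simp only [map_smul, smul_add, RingHom.id_apply])

/-- The pairs `(u, f)` with `u` in the domain of the form and `q(w, u) = (w, f)` for all `w` in the
domain of the form. -/
def operatorGraph (q : SesqForm H) : Submodule ℂ (H × H) where
  carrier := {p | ∃ u : q.domain, (u : H) = p.1 ∧ ∀ w : q.domain, q.form w u = ⟪(w : H), p.2⟫_ℂ}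
  zero_mem' := ⟨0, rfl, by simp⟩
  add_mem' := by
    rintro p p' ⟨u, hu, h⟩ ⟨u', hu', h'⟩
    exact ⟨u + u', by simp [hu, hu'], fun w => by simp [h, h']⟩
  smul_mem' := by
    rintro c p ⟨u, hu, h⟩
    exact ⟨c • u, by simp [hu], fun w => by simp [h]⟩

/-- The operator associated with a densely defined form `q`: its domain consists of the `u` in the
domain of `q` for which there is `f` with `q(w, u) = (w, f)` for all `w` in the domain of `q`, and
it maps `u` to `f`. -/
def operator (q : SesqForm H) : H →ₗ.[ℂ] H := q.operatorGraph.toLinearPMap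

/-- `b` is infinitesimally form bounded with respect to `q`. -/
def IsInfinitesimallyBounded (b q : SesqForm H) : Prop :=
  ∃ hle : q.domain ≤ b.domain, ∀ α : ℝ, 0 < α → ∃ η : ℝ, 0 ≤ η ∧ ∀ u : q.domain,
    ‖b.form (Submodule.inclusion hle u) (Submodule.inclusion hle u)‖ ≤
      α * ‖q.form u u‖ + η * ‖(u : H)‖ ^ 2

end SesqForm

/-! ### `L²(Ω)`, weak gradients and the Sobolev space `W^{1,2}(Ω)` -/

section Sobolev

variable {n : ℕ}

/-- `L²(Ω)`, complex-valued. -/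
abbrev L2 (Ω : Set (EuclideanSpace ℝ (Fin n))) := Lp ℂ 2 (volume.restrict Ω)

/-- `L²(Ω)ⁿ`, that is, `L²(Ω; ℂⁿ)`. -/
abbrev L2vec (Ω : Set (EuclideanSpace ℝ (Fin n))) :=
  Lp (EuclideanSpace ℂ (Fin n)) 2 (volume.restrict Ω)

/-- `φ ∈ C₀^∞(Ω)`. -/
def IsTestFunction (Ω : Set (EuclideanSpace ℝ (Fin n))) (φ : EuclideanSpace ℝ (Fin n) → ℂ) : Prop :=
  ContDiff ℝ ∞ φ ∧ HasCompactSupport φ ∧ tsupport φ ⊆ Ω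

/-- The partial derivative `∂_j φ`. -/
def partialDeriv (j : Fin n) (φ : EuclideanSpace ℝ (Fin n) → ℂ) (x : EuclideanSpace ℝ (Fin n)) :
    ℂ :=
  fderiv ℝ φ x (EuclideanSpace.single j 1)

theorem IsTestFunction.memLp {Ω : Set (EuclideanSpace ℝ (Fin n))}
    {φ : EuclideanSpace ℝ (Fin n) → ℂ} (h : IsTestFunction Ω φ) :
    MemLp φ 2 (volume.restrict Ω) :=
  (h.1.continuous.memLp_of_hasCompactSupport h.2.1).restrict Ω

theorem IsTestFunction.memLp_partialDeriv {Ω : Set (EuclideanSpace ℝ (Fin n))}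
    {φ : EuclideanSpace ℝ (Fin n) → ℂ} (h : IsTestFunction Ω φ) (j : Fin n) :
    MemLp (partialDeriv j φ) 2 (volume.restrict Ω) := by
  have hc : Continuous (partialDeriv j φ) :=
    (h.1.continuous_fderiv (by simp)).clm_apply continuous_const
  have hs : HasCompactSupport (partialDeriv j φ) := by
    refine (h.2.1.fderiv (𝕜 := ℝ)).mono ?_
    intro x hx hx0
    apply hx
    simp [partialDeriv, hx0]
  exact (hc.memLp_of_hasCompactSupport hs).restrict Ω

theorem memLp_coord {Ω : Set (EuclideanSpace ℝ (Fin n))} (G : L2vec Ω) (j : Fin n) :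
    MemLp (fun x => G x j) 2 (volume.restrict Ω) :=
  (Lp.memLp G).continuousLinearMap_comp (EuclideanSpace.proj (𝕜 := ℂ) j)

/-- The pairs `(f, G)` such that `f ∈ L²(Ω)` has the weak gradient `G ∈ L²(Ω)ⁿ`. -/
def sobolevGraph (Ω : Set (EuclideanSpace ℝ (Fin n))) : Submodule ℂ (L2 Ω × L2vec Ω) where
  carrier := {p | ∀ φ, IsTestFunction Ω φ → ∀ j : Fin n,
    ∫ x in Ω, p.1 x * partialDeriv j φ x = -∫ x in Ω, p.2 x j * φ x}
  zero_mem' := by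
    intro φ hφ j
    have h1 : ∫ x in Ω, (0 : L2 Ω) x * partialDeriv j φ x = 0 := by
      refine integral_eq_zero_of_ae ?_
      filter_upwards [Lp.coeFn_zero ℂ 2 (volume.restrict Ω)] with x hx
      rw [hx, Pi.zero_apply, zero_mul]
    have h2 : ∫ x in Ω, (0 : L2vec Ω) x j * φ x = 0 := by
      refine integral_eq_zero_of_ae ?_
      filter_upwards [Lp.coeFn_zero (EuclideanSpace ℂ (Fin n)) 2 (volume.restrict Ω)] with x hx
      rw [hx, Pi.zero_apply, PiLp.zero_apply, zero_mul]
      rfl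
    simp only [Prod.fst_zero, Prod.snd_zero]
    rw [h1, h2, neg_zero]
  add_mem' := by
    intro p q hp hq φ hφ j
    have h1 : ∫ x in Ω, (p.1 + q.1) x * partialDeriv j φ x =
        (∫ x in Ω, p.1 x * partialDeriv j φ x) + ∫ x in Ω, q.1 x * partialDeriv j φ x := by
      refine Eq.trans (integral_congr_ae ?_)
        (integral_add ((Lp.memLp p.1).integrable_mul (hφ.memLp_partialDeriv j))
          ((Lp.memLp q.1).integrable_mul (hφ.memLp_partialDeriv j)))
      filter_upwards [Lp.coeFn_add p.1 q.1] with x hx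
      simp only [hx, Pi.add_apply, add_mul]
    have h2 : ∫ x in Ω, (p.2 + q.2) x j * φ x =
        (∫ x in Ω, p.2 x j * φ x) + ∫ x in Ω, q.2 x j * φ x := by
      refine Eq.trans (integral_congr_ae ?_)
        (integral_add ((memLp_coord p.2 j).integrable_mul hφ.memLp)
          ((memLp_coord q.2 j).integrable_mul hφ.memLp))
      filter_upwards [Lp.coeFn_add p.2 q.2] with x hx
      simp only [hx, Pi.add_apply, PiLp.add_apply, add_mul]
    simp only [Prod.fst_add, Prod.snd_add]
    rw [h1, h2, hp φ hφ j, hq φ hφ j, neg_add]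
  smul_mem' := by
    intro c p hp φ hφ j
    have h1 : ∫ x in Ω, (c • p.1) x * partialDeriv j φ x =
        c * ∫ x in Ω, p.1 x * partialDeriv j φ x := by
      rw [← integral_const_mul]
      refine integral_congr_ae ?_
      filter_upwards [Lp.coeFn_smul c p.1] with x hx
      simp [hx, mul_assoc]
    have h2 : ∫ x in Ω, (c • p.2) x j * φ x = c * ∫ x in Ω, p.2 x j * φ x := by
      rw [← integral_const_mul]
      refine integral_congr_ae ?_
      filter_upwards [Lp.coeFn_smul c p.2] with x hx
      simp [hx, mul_assoc]
    simp only [Prod.smul_fst, Prod.smul_snd]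
    rw [h1, h2, hp φ hφ j, mul_neg]

/-- The weak gradient as an operator from `L²(Ω)` to `L²(Ω)ⁿ`; its domain is `W^{1,2}(Ω)`. -/
def weakGrad (Ω : Set (EuclideanSpace ℝ (Fin n))) : L2 Ω →ₗ.[ℂ] L2vec Ω :=
  (sobolevGraph Ω).toLinearPMap

/-- The Sobolev space `W^{1,2}(Ω)`: the `f ∈ L²(Ω)` with a weak gradient in `L²(Ω)ⁿ`. -/
abbrev sobolev (Ω : Set (EuclideanSpace ℝ (Fin n))) : Submodule ℂ (L2 Ω) := (weakGrad Ω).domain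

/-- `𝒲` is a closed subspace of `W^{1,2}(Ω)` that contains `C₀^∞(Ω)`. Closedness is expressed in
`L²(Ω) × L²(Ω)ⁿ`, in which `f ↦ (f, ∇f)` embeds `W^{1,2}(Ω)` as a closed subspace. -/
structure IsFormSpace (Ω : Set (EuclideanSpace ℝ (Fin n))) (𝒲 : Submodule ℂ (L2 Ω)) : Prop where
  le_sobolev : 𝒲 ≤ sobolev Ω
  isClosed : IsClosed {p : L2 Ω × L2vec Ω | p ∈ sobolevGraph Ω ∧ p.1 ∈ 𝒲}
  test_mem : ∀ f : L2 Ω, ∀ φ, IsTestFunction Ω φ → f =ᵐ[volume.restrict Ω] φ → f ∈ 𝒲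

/-! ### The elliptic form and the form of the potential -/

/-- `a` is a measurable, bounded and uniformly elliptic matrix-valued function on `Ω`, with
constants `0 < a₁ ≤ a₂`. -/
structure IsUniformlyElliptic (Ω : Set (EuclideanSpace ℝ (Fin n)))
    (a : EuclideanSpace ℝ (Fin n) → Matrix (Fin n) (Fin n) ℂ) (a₁ a₂ : ℝ) : Prop where
  measurable : ∀ i j, AEMeasurable (fun x => a x i j) (volume.restrict Ω)
  pos : 0 < a₁
  le : a₁ ≤ a₂
  elliptic : ∀ᵐ x ∂volume.restrict Ω, ∀ ξ : EuclideanSpace ℂ (Fin n),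
    a₁ * ‖ξ‖ ^ 2 ≤ (⟪ξ, Matrix.toEuclideanLin (a x) ξ⟫_ℂ).re
  bounded : ∀ᵐ x ∂volume.restrict Ω, ∀ ξ ζ : EuclideanSpace ℂ (Fin n),
    ‖⟪ζ, Matrix.toEuclideanLin (a x) ξ⟫_ℂ‖ ≤ a₂ * ‖ξ‖ * ‖ζ‖

/-- The constant identity matrix is uniformly elliptic. -/
theorem isUniformlyElliptic_one (Ω : Set (EuclideanSpace ℝ (Fin n))) :
    IsUniformlyElliptic Ω (fun _ => 1) 1 1 where
  measurable _ _ := aemeasurable_const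
  pos := one_pos
  le := le_rfl
  elliptic := Filter.Eventually.of_forall fun x ξ => by
    have h : (⟪ξ, ξ⟫_ℂ).re = ‖ξ‖ ^ 2 := inner_self_eq_norm_sq (𝕜 := ℂ) ξ
    rw [Matrix.toLpLin_one, LinearMap.id_apply, h, one_mul]
  bounded := Filter.Eventually.of_forall fun x ξ ζ => by
    simpa [Matrix.toLpLin_one, mul_comm] using norm_inner_le_norm (𝕜 := ℂ) ζ ξ

theorem IsUniformlyElliptic.integrable {Ω : Set (EuclideanSpace ℝ (Fin n))}
    {a : EuclideanSpace ℝ (Fin n) → Matrix (Fin n) (Fin n) ℂ} {a₁ a₂ : ℝ}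
    (ha : IsUniformlyElliptic Ω a a₁ a₂) (F G : L2vec Ω) :
    Integrable (fun x => ⟪F x, Matrix.toEuclideanLin (a x) (G x)⟫_ℂ) (volume.restrict Ω) := by
  have hb : Integrable (fun x => a₂ * (‖G x‖ * ‖F x‖)) (volume.restrict Ω) :=
    ((Lp.memLp G).norm.integrable_mul (Lp.memLp F).norm).const_mul a₂
  refine hb.mono' ?_ ?_
  · have h : (fun x => ⟪F x, Matrix.toEuclideanLin (a x) (G x)⟫_ℂ) =
        fun x => ∑ i, (∑ j, a x i j * G x j) * starRingEnd ℂ (F x i) := by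
      funext x
      simp [PiLp.inner_apply, Matrix.mulVec, dotProduct]
    rw [h]
    refine Finset.aestronglyMeasurable_fun_sum _ fun i _ => ?_
    refine (Finset.aestronglyMeasurable_fun_sum _ fun j _ => ?_).mul ?_
    · exact (ha.measurable i j).aestronglyMeasurable.mul (memLp_coord G j).1
    · exact Complex.continuous_conj.comp_aestronglyMeasurable (memLp_coord F i).1
  · filter_upwards [ha.bounded] with x hx
    rw [← mul_assoc]
    exact hx _ _

/-- The form `(F, G) ↦ ∫_Ω (F(x), a(x) G(x)) dx` on `L²(Ω)ⁿ`. -/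
def matrixForm {Ω : Set (EuclideanSpace ℝ (Fin n))}
    {a : EuclideanSpace ℝ (Fin n) → Matrix (Fin n) (Fin n) ℂ} {a₁ a₂ : ℝ}
    (ha : IsUniformlyElliptic Ω a a₁ a₂) : L2vec Ω →ₗ⋆[ℂ] L2vec Ω →ₗ[ℂ] ℂ :=
  LinearMap.mk₂'ₛₗ (starRingEnd ℂ) (RingHom.id ℂ)
    (fun F G => ∫ x in Ω, ⟪F x, Matrix.toEuclideanLin (a x) (G x)⟫_ℂ)
    (fun F F' G => by
      rw [← integral_add (ha.integrable _ _) (ha.integrable _ _)]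
      refine integral_congr_ae ?_
      filter_upwards [Lp.coeFn_add F F'] with x hx
      simp only [hx, Pi.add_apply, inner_add_left])
    (fun c F G => by
      rw [smul_eq_mul, ← integral_const_mul]
      refine integral_congr_ae ?_
      filter_upwards [Lp.coeFn_smul c F] with x hx
      simp only [hx, Pi.smul_apply, inner_smul_left])
    (fun F G G' => by
      rw [← integral_add (ha.integrable _ _) (ha.integrable _ _)]
      refine integral_congr_ae ?_
      filter_upwards [Lp.coeFn_add G G'] with x hx
      simp only [hx, Pi.add_apply, map_add, inner_add_right])
    (fun c F G => by
      rw [smul_eq_mul, ← integral_const_mul]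
      refine integral_congr_ae ?_
      filter_upwards [Lp.coeFn_smul c G] with x hx
      simp only [hx, Pi.smul_apply, map_smul, inner_smul_right, RingHom.id_apply])

/-- The weak gradient on `𝒲`. -/
def gradOn {Ω : Set (EuclideanSpace ℝ (Fin n))} {𝒲 : Submodule ℂ (L2 Ω)}
    (h𝒲 : IsFormSpace Ω 𝒲) : 𝒲 →ₗ[ℂ] L2vec Ω :=
  (weakGrad Ω).toFun ∘ₗ Submodule.inclusion h𝒲.le_sobolev

/-- The form `q_{a,𝒲}(f, g) = ∫_Ω (∇f(x), a(x) ∇g(x)) dx` with domain `𝒲`. -/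
def ellipticForm {Ω : Set (EuclideanSpace ℝ (Fin n))} {𝒲 : Submodule ℂ (L2 Ω)}
    (h𝒲 : IsFormSpace Ω 𝒲) {a : EuclideanSpace ℝ (Fin n) → Matrix (Fin n) (Fin n) ℂ} {a₁ a₂ : ℝ}
    (ha : IsUniformlyElliptic Ω a a₁ a₂) : SesqForm (L2 Ω) where
  domain := 𝒲
  form := LinearMap.mk₂'ₛₗ (starRingEnd ℂ) (RingHom.id ℂ)
    (fun f g => matrixForm ha (gradOn h𝒲 f) (gradOn h𝒲 g))
    (fun f f' g => by rw [map_add, map_add, LinearMap.add_apply])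
    (fun c f g => by rw [map_smul, map_smulₛₗ, LinearMap.smul_apply])
    (fun f g g' => by rw [map_add, map_add])
    (fun c f g => by rw [map_smul, map_smul, RingHom.id_apply])

/-- The operator `L_{a,𝒲}` associated with the form `q_{a,𝒲}`. -/
def ellipticOp {Ω : Set (EuclideanSpace ℝ (Fin n))} {𝒲 : Submodule ℂ (L2 Ω)}
    (h𝒲 : IsFormSpace Ω 𝒲) {a : EuclideanSpace ℝ (Fin n) → Matrix (Fin n) (Fin n) ℂ} {a₁ a₂ : ℝ}
    (ha : IsUniformlyElliptic Ω a a₁ a₂) : L2 Ω →ₗ.[ℂ] L2 Ω :=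
  (ellipticForm h𝒲 ha).operator

/-- The operator `-Δ_𝒲`, that is, `L_{a,𝒲}` for the identity matrix `a`. -/
def negLaplacian {Ω : Set (EuclideanSpace ℝ (Fin n))} {𝒲 : Submodule ℂ (L2 Ω)}
    (h𝒲 : IsFormSpace Ω 𝒲) : L2 Ω →ₗ.[ℂ] L2 Ω :=
  ellipticOp h𝒲 (isUniformlyElliptic_one Ω)

/-- The `f ∈ L²(Ω)` with `m f ∈ L²(Ω)`. -/
def mulDomain (Ω : Set (EuclideanSpace ℝ (Fin n))) (m : EuclideanSpace ℝ (Fin n) → ℂ) :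
    Submodule ℂ (L2 Ω) where
  carrier := {f | MemLp (fun x => m x * f x) 2 (volume.restrict Ω)}
  zero_mem' := by
    refine MemLp.ae_eq ?_ (MemLp.zero' (ε := ℂ) (p := 2) (μ := volume.restrict Ω))
    filter_upwards [Lp.coeFn_zero ℂ 2 (volume.restrict Ω)] with x hx
    rw [hx, Pi.zero_apply, mul_zero]
  add_mem' := by
    intro f g hf hg
    refine MemLp.ae_eq ?_ (MemLp.add hf hg)
    filter_upwards [Lp.coeFn_add f g] with x hx
    rw [hx, Pi.add_apply, Pi.add_apply, mul_add]
  smul_mem' := by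
    intro c f hf
    refine MemLp.ae_eq ?_ (MemLp.const_smul hf c)
    filter_upwards [Lp.coeFn_smul c f] with x hx
    rw [hx, Pi.smul_apply, Pi.smul_apply, smul_eq_mul, smul_eq_mul, mul_left_comm]

theorem mem_mulDomain {Ω : Set (EuclideanSpace ℝ (Fin n))} {m : EuclideanSpace ℝ (Fin n) → ℂ}
    {f : L2 Ω} : f ∈ mulDomain Ω m ↔ MemLp (fun x => m x * f x) 2 (volume.restrict Ω) :=
  Iff.rfl

/-- The maximal operator of multiplication by `m` in `L²(Ω)`. -/
def mulOp (Ω : Set (EuclideanSpace ℝ (Fin n))) (m : EuclideanSpace ℝ (Fin n) → ℂ) :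
    L2 Ω →ₗ.[ℂ] L2 Ω where
  domain := mulDomain Ω m
  toFun :=
    { toFun := fun f => (mem_mulDomain.1 f.2).toLp (fun x => m x * (f : L2 Ω) x)
      map_add' := by
        rintro ⟨f, hf⟩ ⟨g, hg⟩
        rw [← MemLp.toLp_add]
        refine MemLp.toLp_congr _ _ ?_
        filter_upwards [Lp.coeFn_add f g] with x hx
        change m x * (f + g : L2 Ω) x = m x * f x + m x * g x
        rw [hx, Pi.add_apply, mul_add]
      map_smul' := by
        rintro c ⟨f, hf⟩
        rw [RingHom.id_apply, ← MemLp.toLp_const_smul]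
        refine MemLp.toLp_congr _ _ ?_
        filter_upwards [Lp.coeFn_smul c f] with x hx
        change m x * (c • f : L2 Ω) x = c • (m x * f x)
        rw [hx, Pi.smul_apply, smul_eq_mul, smul_eq_mul, mul_left_comm] }

/-- `v(x) = |V(x)|^{1/2}`. -/
def vPart (V : EuclideanSpace ℝ (Fin n) → ℂ) (x : EuclideanSpace ℝ (Fin n)) : ℂ :=
  (Real.sqrt ‖V x‖ : ℝ)

/-- `u(x) = e^{i arg(V(x))} |V(x)|^{1/2}`, so that `V = u v`. -/
def uPart (V : EuclideanSpace ℝ (Fin n) → ℂ) (x : EuclideanSpace ℝ (Fin n)) : ℂ :=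
  Complex.exp (Complex.I * (Complex.arg (V x) : ℂ)) * vPart V x

theorem vPart_domain_le {Ω : Set (EuclideanSpace ℝ (Fin n))} {V : EuclideanSpace ℝ (Fin n) → ℂ}
    (hV : AEMeasurable V (volume.restrict Ω)) :
    (mulOp Ω (vPart V)).domain ≤ (mulOp Ω (uPart V)).domain := by
  intro f hf
  have hf' : MemLp (fun x => vPart V x * f x) 2 (volume.restrict Ω) := hf
  have hm : AEStronglyMeasurable (fun x => Complex.exp (Complex.I * (Complex.arg (V x) : ℂ)))
      (volume.restrict Ω) := by
    refine AEMeasurable.aestronglyMeasurable ?_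
    exact Complex.measurable_exp.comp_aemeasurable
      (((Complex.measurable_ofReal.comp Complex.measurable_arg).comp_aemeasurable hV).const_mul _)
  have h : MemLp (fun x => uPart V x * f x) 2 (volume.restrict Ω) := by
    have he : (fun x => uPart V x * f x) =
        fun x => Complex.exp (Complex.I * (Complex.arg (V x) : ℂ)) * (vPart V x * f x) := by
      funext x
      simp [uPart, mul_assoc]
    rw [he]
    refine hf'.of_le (hm.mul hf'.1) (Filter.Eventually.of_forall fun x => ?_)
    rw [norm_mul, mul_comm Complex.I, Complex.norm_exp_ofReal_mul_I, one_mul]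
  exact h

/-- The form `q_V(f, g) = (v f, e^{i arg V} v g)` with domain `dom(v)`. -/
def potentialForm {Ω : Set (EuclideanSpace ℝ (Fin n))} {V : EuclideanSpace ℝ (Fin n) → ℂ}
    (hV : AEMeasurable V (volume.restrict Ω)) : SesqForm (L2 Ω) where
  domain := (mulOp Ω (vPart V)).domain
  form := LinearMap.mk₂'ₛₗ (starRingEnd ℂ) (RingHom.id ℂ)
    (fun f g => ⟪mulOp Ω (vPart V) f,
      mulOp Ω (uPart V) (Submodule.inclusion (vPart_domain_le hV) g)⟫_ℂ)
    (fun f f' g => by rw [LinearPMap.map_add, inner_add_left])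
    (fun c f g => by rw [LinearPMap.map_smul, inner_smul_left, smul_eq_mul])
    (fun f g g' => by rw [map_add, LinearPMap.map_add, inner_add_right])
    (fun c f g => by
      rw [map_smul, LinearPMap.map_smul, inner_smul_right, smul_eq_mul, RingHom.id_apply])

/-- The form sum `L_{a,𝒲} +_q V`: the operator associated with `q_{a,𝒲} + q_V`. -/
def formSumOp {Ω : Set (EuclideanSpace ℝ (Fin n))} {𝒲 : Submodule ℂ (L2 Ω)}
    (h𝒲 : IsFormSpace Ω 𝒲) {a : EuclideanSpace ℝ (Fin n) → Matrix (Fin n) (Fin n) ℂ} {a₁ a₂ : ℝ}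
    (ha : IsUniformlyElliptic Ω a a₁ a₂) {V : EuclideanSpace ℝ (Fin n) → ℂ}
    (hV : AEMeasurable V (volume.restrict Ω)) : L2 Ω →ₗ.[ℂ] L2 Ω :=
  ((ellipticForm h𝒲 ha).sum (potentialForm hV)).operator

end Sobolev

end

/-! Everything is reduced to a Hilbert-space statement. The form domain 𝒲 with the `W^{1,2}` norm is
a Hilbert space `K`, embedded in `H = L²(Ω)` by an injective bounded `J` with dense range. A form on
𝒲 becomes `⟪w, A u⟫` with `A` bounded on `K`. Its operator `T` has the resolvent `(T + z)⁻¹ = J (A +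
z J*J)⁻¹ J*`. For the elliptic form `A₀ = D*BD`, with `D` the gradient and `B` multiplication by
`a`. The potential adds `T_v* U`, where `T_v` and `U` are multiplication by `v` and by `e^{i arg V}
v`.

Square roots enter only through `Q_e = π⁻¹ ∫₀^∞ s^{-1/2} (S + e + s)⁻¹ ds`. It satisfies `Q_e² = (S
+ e)⁻¹` (`IsResolventFamily.sqrtInv_mul_self`), and the Balakrishnan operator differs from `Q_e⁻¹`
by a bounded operator of norm at most `√e`. Hence `dom(S^{1/2}) = ran Q_e` for every `e > 0`
(`HasResolvent.sqrtOp_domain`), and the theorem becomes a statement about ranges.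

By the second resolvent equation the perturbed `Q` differs from the unperturbed one by `J ∫ s^{-1/2}
Z(s) ds`, where `Z(s)` maps into `K` and contains the factor `U (A + (e+s) J*J)⁻¹ J*`. The energy
estimate alone gives this factor the decay `(1+s)^{-1/2}`, which diverges logarithmically against
`s^{-1/2}`. Choosing `ε` as a power of `1+s` in the polynomial form bound improves it to
`(1+s)^{-1/2-δ}`. The integral then converges in `K`, so `ran Q ⊆ ran J`
(`range_sqrtInv_le_of_perturbation`), and likewise for the adjoint. The two inclusions imply the
reverse ones: `Q* = J G` gives `Q G* = J X` with `X = (A + e J*J)⁻¹` surjective, so `ran J ⊆ ran Q`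
(`range_le_range_of_adjoint_range_le`).

The hypothesis is stated with `(-Δ)^{1/2}`. The symmetric case of the same calculus gives
`‖(-Δ)^{1/2} f‖ ≤ ‖∇f‖` on 𝒲 (`SesqForm.IsRepresentedBy.norm_sqrtOp_sq_le`), which turns it into a
bound by the gradient. Part (i) and quasi-coercivity of the form sum follow by ellipticity. -/

section ScalarIntegrals

/-! ### The scalar integral of `s^{-1/2} (τ+s)⁻¹`. -/

open Filter Real

theorem rpow_neg_half_eq_inv_sqrt {s : ℝ} (hs : 0 ≤ s) : s ^ (-(1 / 2) : ℝ) = (√s)⁻¹ := by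
  rw [Real.rpow_neg hs, Real.sqrt_eq_rpow]

theorem continuousOn_rpow_neg_half : ContinuousOn (fun s : ℝ => s ^ (-(1 / 2) : ℝ)) (Ioi 0) :=
  fun s hs => (Real.continuousAt_rpow_const s _ (Or.inl (ne_of_gt hs))).continuousWithinAt

theorem hasDerivAt_arctan_sqrt {τ : ℝ} (hτ : 0 < τ) {s : ℝ} (hs : 0 < s) :
    HasDerivAt (fun s => 2 / √τ * Real.arctan (√s / √τ)) (s ^ (-(1 / 2) : ℝ) * (τ + s)⁻¹) s := by
  have h1 := (((Real.hasDerivAt_sqrt hs.ne').div_const (√τ)).arctan).const_mul (2 / √τ)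
  refine h1.congr_deriv ?_
  rw [rpow_neg_half_eq_inv_sqrt hs.le]
  have h2 : √τ ≠ 0 := (Real.sqrt_pos.2 hτ).ne'
  have h3 : √s ≠ 0 := (Real.sqrt_pos.2 hs).ne'
  have h4 : √τ ^ 2 = τ := Real.sq_sqrt hτ.le
  have h5 : √s ^ 2 = s := Real.sq_sqrt hs.le
  have h6 : τ + s ≠ 0 := by positivity
  have h7 : √τ ^ 2 + √s ^ 2 ≠ 0 := by rw [h4, h5]; exact h6
  have h8 : 1 + (√s / √τ) ^ 2 = (τ + s) / √τ ^ 2 := by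
    field_simp
    rw [h4, h5]
  rw [h8]
  field_simp

theorem tendsto_arctan_sqrt {τ : ℝ} (hτ : 0 < τ) :
    Tendsto (fun s => 2 / √τ * Real.arctan (√s / √τ)) atTop (𝓝 (2 / √τ * (π / 2))) := by
  refine Tendsto.const_mul _ ((tendsto_nhds_of_tendsto_nhdsWithin Real.tendsto_arctan_atTop).comp ?_)
  exact Real.tendsto_sqrt_atTop.atTop_div_const (Real.sqrt_pos.2 hτ)

theorem continuous_arctan_sqrt (τ : ℝ) :
    Continuous (fun s => 2 / √τ * Real.arctan (√s / √τ)) := by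
  fun_prop

theorem integrableOn_rpow_neg_half_mul_inv {τ : ℝ} (hτ : 0 < τ) :
    IntegrableOn (fun s : ℝ => s ^ (-(1 / 2) : ℝ) * (τ + s)⁻¹) (Ioi 0) :=
  integrableOn_Ioi_deriv_of_nonneg (continuous_arctan_sqrt τ).continuousWithinAt
    (fun _ hs => hasDerivAt_arctan_sqrt hτ hs)
    (fun s (hs : 0 < s) => by positivity) (tendsto_arctan_sqrt hτ)

theorem integral_rpow_neg_half_mul_inv {τ : ℝ} (hτ : 0 < τ) :
    ∫ s in Ioi (0 : ℝ), s ^ (-(1 / 2) : ℝ) * (τ + s)⁻¹ = π * (√τ)⁻¹ := by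
  rw [integral_Ioi_of_hasDerivAt_of_nonneg (continuous_arctan_sqrt τ).continuousWithinAt
    (fun _ hs => hasDerivAt_arctan_sqrt hτ hs)
    (fun s (hs : 0 < s) => by positivity) (tendsto_arctan_sqrt hτ)]
  simp
  ring

end ScalarIntegrals

/-! ### Vector-valued integrals against `s^{-1/2}`. -/

section SqrtInv

variable {𝔸 : Type*} [NormedAddCommGroup 𝔸] [NormedSpace ℝ 𝔸]

/-- The integral `π⁻¹ ∫₀^∞ s ^ (-1/2) R(τ + s) ds`; if `R(s) = (S + s)⁻¹`, this is
`(S + τ)^{-1/2}`. -/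
noncomputable def sqrtInv (R : ℝ → 𝔸) (τ : ℝ) : 𝔸 :=
  Real.pi⁻¹ • ∫ s in Ioi (0 : ℝ), s ^ (-(1 / 2) : ℝ) • R (τ + s)

theorem norm_integral_rpow_smul_le {F : ℝ → 𝔸} {c τ : ℝ} (hτ : 0 < τ)
    (hb : ∀ s, 0 < s → ‖F s‖ ≤ c * (τ + s)⁻¹) :
    ‖Real.pi⁻¹ • ∫ s in Ioi (0 : ℝ), s ^ (-(1 / 2) : ℝ) • F s‖ ≤ c * (√τ)⁻¹ := by
  have h1 : ‖∫ s in Ioi (0 : ℝ), s ^ (-(1 / 2) : ℝ) • F s‖ ≤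
      ∫ s in Ioi (0 : ℝ), c * (s ^ (-(1 / 2) : ℝ) * (τ + s)⁻¹) := by
    refine norm_integral_le_of_norm_le ((integrableOn_rpow_neg_half_mul_inv hτ).const_mul c) ?_
    filter_upwards [ae_restrict_mem measurableSet_Ioi] with s (hs : 0 < s)
    rw [norm_smul, Real.norm_of_nonneg (by positivity), mul_left_comm]
    exact mul_le_mul_of_nonneg_left (hb s hs) (by positivity)
  rw [integral_const_mul, integral_rpow_neg_half_mul_inv hτ] at h1
  rw [norm_smul, norm_inv, Real.norm_of_nonneg Real.pi_pos.le]
  calc Real.pi⁻¹ * _ ≤ Real.pi⁻¹ * (c * (Real.pi * (√τ)⁻¹)) := by gcongr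
    _ = c * (√τ)⁻¹ := by
      have := Real.pi_ne_zero
      field_simp

theorem integrableOn_rpow_smul {F : ℝ → 𝔸} {c τ : ℝ} (hτ : 0 < τ)
    (hF : ContinuousOn F (Ioi 0)) (hb : ∀ s, 0 < s → ‖F s‖ ≤ c * (τ + s)⁻¹) :
    IntegrableOn (fun s : ℝ => s ^ (-(1 / 2) : ℝ) • F s) (Ioi 0) := by
  refine Integrable.mono' ((integrableOn_rpow_neg_half_mul_inv hτ).const_mul c)
    ((continuousOn_rpow_neg_half.smul hF).aestronglyMeasurable measurableSet_Ioi) ?_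
  filter_upwards [ae_restrict_mem measurableSet_Ioi] with s (hs : 0 < s)
  rw [norm_smul, Real.norm_of_nonneg (by positivity), mul_left_comm]
  exact mul_le_mul_of_nonneg_left (hb s hs) (by positivity)

end SqrtInv

/-! ### The inverse square root of a resolvent family squares to the resolvent. -/

section ResolventFamily

open Filter

variable {𝔸 : Type*} [NormedRing 𝔸] [NormedAlgebra ℝ 𝔸]

/-- A family satisfying the first resolvent equation of `R(s) = (S + s)⁻¹`, with the bound
`‖R(s)‖ ≤ s⁻¹`. -/
structure IsResolventFamily (R : ℝ → 𝔸) : Prop where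
  norm_le : ∀ s, 0 < s → ‖R s‖ ≤ s⁻¹
  resolvent : ∀ s t, 0 < s → 0 < t → R s - R t = (t - s) • (R s * R t)

namespace IsResolventFamily

variable {R : ℝ → 𝔸} (hR : IsResolventFamily R)
include hR

theorem commute {s t : ℝ} (hs : 0 < s) (ht : 0 < t) : R s * R t = R t * R s := by
  rcases eq_or_ne s t with rfl | hst
  · rfl
  have h1 := hR.resolvent s t hs ht
  have h2 := hR.resolvent t s ht hs
  have h3 : (t - s) • (R s * R t) = (t - s) • (R t * R s) := by
    rw [← h1, ← neg_sub (R t), h2, ← neg_smul, neg_sub]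
  exact smul_right_injective 𝔸 (sub_ne_zero.2 hst.symm) h3

theorem continuousAt {s : ℝ} (hs : 0 < s) : ContinuousAt R s := by
  rw [ContinuousAt, tendsto_iff_norm_sub_tendsto_zero]
  have hb : Tendsto (fun t => |s - t| * ((s / 2)⁻¹ * s⁻¹)) (𝓝 s) (𝓝 0) := by
    have : Continuous (fun t => |s - t| * ((s / 2)⁻¹ * s⁻¹)) := by fun_prop
    simpa using this.tendsto s
  refine squeeze_zero' (Eventually.of_forall fun _ => norm_nonneg _) ?_ hb
  filter_upwards [lt_mem_nhds (half_lt_self hs)] with t ht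
  have ht0 : 0 < t := by linarith
  rw [hR.resolvent t s ht0 hs, norm_smul, Real.norm_eq_abs]
  refine mul_le_mul_of_nonneg_left ((norm_mul_le _ _).trans ?_) (abs_nonneg _)
  have h1 := hR.norm_le t ht0
  have h2 := hR.norm_le s hs
  have h3 : t⁻¹ ≤ (s / 2)⁻¹ := by gcongr
  gcongr
  exact h1.trans h3

theorem hasDerivAt {s : ℝ} (hs : 0 < s) : HasDerivAt R (-(R s * R s)) s := by
  rw [hasDerivAt_iff_tendsto_slope]
  have h1 : Tendsto (fun t => -(R t * R s)) (𝓝[≠] s) (𝓝 (-(R s * R s))) :=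
    (((hR.continuousAt hs).mul continuousAt_const).neg).tendsto.mono_left nhdsWithin_le_nhds
  refine h1.congr' ?_
  filter_upwards [self_mem_nhdsWithin, nhdsWithin_le_nhds (lt_mem_nhds hs)] with t ht ht0
  rw [slope_def_module, hR.resolvent t s ht0 hs, smul_smul,
    ← neg_sub t s, mul_neg, inv_mul_cancel₀ (sub_ne_zero.2 ht), neg_one_smul]

theorem continuousOn_add {τ : ℝ} (hτ : 0 < τ) : ContinuousOn (fun s => R (τ + s)) (Ioi 0) :=
  fun s (hs : 0 < s) => ((hR.continuousAt (add_pos hτ hs)).comp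
    (f := fun s => τ + s) (by fun_prop)).continuousWithinAt

theorem norm_add_le {τ s : ℝ} (hτ : 0 < τ) (hs : 0 < s) : ‖R (τ + s)‖ ≤ 1 * (τ + s)⁻¹ := by
  rw [one_mul]
  exact hR.norm_le _ (add_pos hτ hs)

theorem integrableOn {τ : ℝ} (hτ : 0 < τ) :
    IntegrableOn (fun s : ℝ => s ^ (-(1 / 2) : ℝ) • R (τ + s)) (Ioi 0) :=
  integrableOn_rpow_smul hτ (hR.continuousOn_add hτ) fun _ => hR.norm_add_le hτ

theorem norm_sqrtInv_le {τ : ℝ} (hτ : 0 < τ) : ‖sqrtInv R τ‖ ≤ (√τ)⁻¹ := by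
  simpa [sqrtInv] using norm_integral_rpow_smul_le hτ fun _ => hR.norm_add_le hτ

theorem norm_mul_add_le {τ s : ℝ} (hτ : 0 < τ) (hs : 0 < s) :
    ‖R (τ + s) * R (τ + s)‖ ≤ τ⁻¹ * (τ + s)⁻¹ := by
  have h1 := hR.norm_le _ (add_pos hτ hs)
  have h2 : (τ + s)⁻¹ ≤ τ⁻¹ := by gcongr; linarith
  refine (norm_mul_le _ _).trans ?_
  gcongr
  exact h1.trans h2

theorem integrableOn_mul {τ : ℝ} (hτ : 0 < τ) :
    IntegrableOn (fun s : ℝ => s ^ (-(1 / 2) : ℝ) • (R (τ + s) * R (τ + s))) (Ioi 0) :=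
  integrableOn_rpow_smul hτ ((hR.continuousOn_add hτ).mul (hR.continuousOn_add hτ))
    fun _ => hR.norm_mul_add_le hτ

theorem integrableOn_smul_mul {τ : ℝ} (hτ : 0 < τ) :
    IntegrableOn (fun s : ℝ => s ^ (-(1 / 2) : ℝ) • (s • (R (τ + s) * R (τ + s)))) (Ioi 0) := by
  refine integrableOn_rpow_smul (c := 1) hτ (continuousOn_id.smul
    ((hR.continuousOn_add hτ).mul (hR.continuousOn_add hτ))) fun s hs => ?_
  have h1 := hR.norm_le _ (add_pos hτ hs)
  change ‖s • (R (τ + s) * R (τ + s))‖ ≤ _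
  rw [norm_smul, Real.norm_of_nonneg hs.le, one_mul]
  calc s * ‖R (τ + s) * R (τ + s)‖ ≤ (τ + s) * ((τ + s)⁻¹ * (τ + s)⁻¹) := by
        gcongr
        · linarith
        · refine (norm_mul_le _ _).trans ?_
          gcongr
    _ = (τ + s)⁻¹ := by
      have : τ + s ≠ 0 := by positivity
      field_simp

theorem mul_sqrtInv {e τ : ℝ} (he : 0 < e) (hτ : 0 < τ) :
    R e * sqrtInv R τ = sqrtInv R τ * R e := by
  rw [sqrtInv, mul_smul_comm, smul_mul_assoc, ← integral_const_mul_of_integrable (hR.integrableOn hτ),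
    ← integral_mul_const_of_integrable (hR.integrableOn hτ)]
  congr 1
  refine setIntegral_congr_fun measurableSet_Ioi fun s (hs : 0 < s) => ?_
  simp only [mul_smul_comm, smul_mul_assoc, hR.commute he (add_pos hτ hs)]

variable [CompleteSpace 𝔸]

/-- Integration by parts: `∫ s^{1/2} R(τ+s)² ds = ½ ∫ s^{-1/2} R(τ+s) ds`. -/
theorem integral_smul_mul {τ : ℝ} (hτ : 0 < τ) :
    ∫ s in Ioi (0 : ℝ), s ^ (-(1 / 2) : ℝ) • (s • (R (τ + s) * R (τ + s))) =
      (1 / 2 : ℝ) • ∫ s in Ioi (0 : ℝ), s ^ (-(1 / 2) : ℝ) • R (τ + s) := by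
  have hd : ∀ s ∈ Ioi (0 : ℝ), HasDerivAt (fun s => √s • R (τ + s))
      ((1 / 2 : ℝ) • (s ^ (-(1 / 2) : ℝ) • R (τ + s)) -
        s ^ (-(1 / 2) : ℝ) • (s • (R (τ + s) * R (τ + s)))) s := by
    intro s (hs : 0 < s)
    have h1 : HasDerivAt (fun s => R (τ + s)) (-(R (τ + s) * R (τ + s))) s :=
      (hR.hasDerivAt (add_pos hτ hs)).comp_const_add τ s
    have h2 := (Real.hasDerivAt_sqrt hs.ne').smul h1
    refine h2.congr_deriv ?_
    rw [rpow_neg_half_eq_inv_sqrt hs.le, smul_smul, smul_smul, smul_neg, sub_eq_neg_add]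
    have h3 : (√s)⁻¹ * s = √s := by
      rw [inv_mul_eq_div, Real.div_sqrt]
    rw [h3]
    congr 2
    have : √s ≠ 0 := (Real.sqrt_pos.2 hs).ne'
    field_simp
  have hc : ContinuousWithinAt (fun s => √s • R (τ + s)) (Ici 0) 0 := by
    refine ContinuousAt.continuousWithinAt (Real.continuous_sqrt.continuousAt.smul ?_)
    exact ContinuousAt.comp (f := fun s => τ + s) (by simpa using hR.continuousAt hτ) (by fun_prop)
  have hl : Tendsto (fun s => √s • R (τ + s)) atTop (𝓝 0) := by
    rw [tendsto_zero_iff_norm_tendsto_zero]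
    have hb : Tendsto (fun s : ℝ => (√s)⁻¹) atTop (𝓝 0) := Real.tendsto_sqrt_atTop.inv_tendsto_atTop
    refine squeeze_zero' (Eventually.of_forall fun _ => norm_nonneg _) ?_ hb
    filter_upwards [eventually_gt_atTop 0] with s hs
    rw [norm_smul, Real.norm_of_nonneg (Real.sqrt_nonneg s)]
    have h1 := hR.norm_le _ (add_pos hτ hs)
    have h2 : (τ + s)⁻¹ ≤ s⁻¹ := by gcongr; linarith
    calc √s * ‖R (τ + s)‖ ≤ √s * s⁻¹ := by gcongr; exact h1.trans h2
      _ = (√s)⁻¹ := by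
        have h3 : √s ≠ 0 := (Real.sqrt_pos.2 hs).ne'
        nth_rw 2 [← Real.mul_self_sqrt hs.le]
        field_simp
  have hi1 : IntegrableOn (fun s : ℝ => (1 / 2 : ℝ) • (s ^ (-(1 / 2) : ℝ) • R (τ + s))) (Ioi 0) :=
    (hR.integrableOn hτ).smul (1 / 2 : ℝ)
  have hi2 := hR.integrableOn_smul_mul hτ
  have h := integral_Ioi_of_hasDerivAt_of_tendsto hc hd (hi1.sub hi2) hl
  rw [integral_sub hi1 hi2, integral_smul] at h
  simp only [Real.sqrt_zero, zero_smul, sub_zero] at h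
  exact (sub_eq_zero.1 h).symm

/-- Differentiation under the integral produces `-R(τ+s)²`. The resolvent equation rewrites
`R(τ+s)²` as `R(τ) (R(τ+s) - s R(τ+s)²)`, and integration by parts identifies the last term with
half of the first. Formally this is the derivative of `(S+τ)^{-1/2}`. -/
theorem hasDerivAt_sqrtInv {τ : ℝ} (hτ : 0 < τ) :
    HasDerivAt (sqrtInv R) (-((1 / 2 : ℝ) • (R τ * sqrtInv R τ))) τ := by
  have hmem : ∀ x ∈ Ioi (τ / 2), 0 < x := fun x hx => lt_trans (half_pos hτ) hx
  have hd := (hasDerivAt_integral_of_dominated_loc_of_deriv_le (μ := volume.restrict (Ioi (0 : ℝ)))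
    (F := fun τ s => s ^ (-(1 / 2) : ℝ) • R (τ + s))
    (F' := fun τ s => -(s ^ (-(1 / 2) : ℝ) • (R (τ + s) * R (τ + s))))
    (bound := fun s => (τ / 2)⁻¹ * (s ^ (-(1 / 2) : ℝ) * (τ / 2 + s)⁻¹))
    (Ioi_mem_nhds (half_lt_self hτ)) ?_ (hR.integrableOn hτ)
    (hR.integrableOn_mul hτ).neg.1 ?_
    ((integrableOn_rpow_neg_half_mul_inv (half_pos hτ)).const_mul _) ?_).2
  · have h := hd.const_smul (Real.pi⁻¹)
    refine h.congr_deriv ?_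
    have hs1 : ∀ s ∈ Ioi (0 : ℝ), s ^ (-(1 / 2) : ℝ) • (R (τ + s) * R (τ + s)) =
        R τ * (s ^ (-(1 / 2) : ℝ) • R (τ + s) - s ^ (-(1 / 2) : ℝ) • (s • (R (τ + s) * R (τ + s)))) := by
      intro s (hs : 0 < s)
      have h1 := hR.resolvent (τ + s) τ (add_pos hτ hs) hτ
      have h2 : R (τ + s) = R τ - s • (R τ * R (τ + s)) := by
        rw [hR.commute hτ (add_pos hτ hs), sub_eq_add_neg, ← neg_smul, ← sub_eq_iff_eq_add', h1]
        congr 1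
        ring
      rw [← smul_sub, mul_smul_comm, mul_sub, mul_smul_comm, ← mul_assoc, ← smul_mul_assoc s,
        ← sub_mul, ← h2]
    rw [integral_neg, setIntegral_congr_fun measurableSet_Ioi hs1,
      integral_const_mul_of_integrable (f := fun s : ℝ => s ^ (-(1 / 2) : ℝ) • R (τ + s) -
        s ^ (-(1 / 2) : ℝ) • (s • (R (τ + s) * R (τ + s))))
        ((hR.integrableOn hτ).sub (hR.integrableOn_smul_mul hτ)),
      integral_sub (hR.integrableOn hτ) (hR.integrableOn_smul_mul hτ), hR.integral_smul_mul hτ,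
      sqrtInv, smul_neg, mul_smul_comm, smul_comm (1 / 2 : ℝ), ← mul_smul_comm (1 / 2 : ℝ)]
    congr 3
    module
  · filter_upwards [lt_mem_nhds hτ] with x hx
    exact (hR.integrableOn hx).1
  · filter_upwards [ae_restrict_mem measurableSet_Ioi] with s (hs : 0 < s) x (hx : τ / 2 < x)
    have hx0 := hmem x hx
    rw [norm_neg, norm_smul, Real.norm_of_nonneg (by positivity), mul_left_comm]
    refine mul_le_mul_of_nonneg_left ((hR.norm_mul_add_le hx0 hs).trans ?_) (by positivity)
    gcongr
  · filter_upwards [ae_restrict_mem measurableSet_Ioi] with s (hs : 0 < s) x (hx : τ / 2 < x)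
    rw [← smul_neg]
    exact ((hR.hasDerivAt (add_pos (hmem x hx) hs)).comp_add_const x s).fun_const_smul _

/-- `√τ (S + τ)^{-1/2} → 1` on the range of `R(e)`, with a rate. -/
theorem norm_sqrt_smul_sqrtInv_mul_sub_le {e τ : ℝ} (he : 0 < e) (hτ : e < τ) :
    ‖√(τ - e) • (sqrtInv R τ * R e) - R e‖ ≤ τ⁻¹ := by
  have hτ0 : 0 < τ := he.trans hτ
  have hd : 0 < τ - e := sub_pos.2 hτ
  have hF : ContinuousOn (fun s => (τ - e + s)⁻¹ • R (τ + s)) (Ioi 0) := by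
    refine ContinuousOn.smul (ContinuousOn.inv₀ (by fun_prop) fun s (hs : 0 < s) => ?_)
      (hR.continuousOn_add hτ0)
    positivity
  have hb : ∀ s, 0 < s → ‖(τ - e + s)⁻¹ • R (τ + s)‖ ≤ τ⁻¹ * (τ - e + s)⁻¹ := by
    intro s hs
    have h1 := hR.norm_le _ (add_pos hτ0 hs)
    have h2 : (τ + s)⁻¹ ≤ τ⁻¹ := by gcongr; linarith
    rw [norm_smul, Real.norm_of_nonneg (by positivity), mul_comm]
    gcongr
    exact h1.trans h2
  have hi := integrableOn_rpow_smul hd hF hb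
  have hi0 : IntegrableOn (fun s : ℝ => (s ^ (-(1 / 2) : ℝ) * (τ - e + s)⁻¹) • R e) (Ioi 0) :=
    (integrableOn_rpow_neg_half_mul_inv hd).smul_const _
  have hkey : sqrtInv R τ * R e = (√(τ - e))⁻¹ • R e -
      Real.pi⁻¹ • ∫ s in Ioi (0 : ℝ), s ^ (-(1 / 2) : ℝ) • ((τ - e + s)⁻¹ • R (τ + s)) := by
    -- The resolvent equation splits `R(τ+s) R(e)` into a scalar multiple of `R(e)`, which
    -- integrates explicitly, and a remainder smaller by a factor `τ⁻¹`.
    have hs1 : ∀ s ∈ Ioi (0 : ℝ), s ^ (-(1 / 2) : ℝ) • R (τ + s) * R e =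
        (s ^ (-(1 / 2) : ℝ) * (τ - e + s)⁻¹) • R e -
          s ^ (-(1 / 2) : ℝ) • ((τ - e + s)⁻¹ • R (τ + s)) := by
      intro s (hs : 0 < s)
      have h0 : τ - e + s ≠ 0 := by positivity
      have h1 := hR.resolvent e (τ + s) he (add_pos hτ0 hs)
      rw [show τ + s - e = τ - e + s by ring, hR.commute he (add_pos hτ0 hs),
        ← inv_smul_eq_iff₀ h0] at h1
      rw [smul_mul_assoc, ← h1, smul_sub, smul_sub, smul_smul]
    rw [sqrtInv, smul_mul_assoc, ← integral_mul_const_of_integrable (hR.integrableOn hτ0),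
      setIntegral_congr_fun measurableSet_Ioi hs1, integral_sub hi0 hi, integral_smul_const,
      integral_rpow_neg_half_mul_inv hd, smul_sub, smul_smul, inv_mul_cancel_left₀ Real.pi_ne_zero]
  have hsq : √(τ - e) ≠ 0 := (Real.sqrt_pos.2 hd).ne'
  rw [hkey, smul_sub, smul_inv_smul₀ hsq, sub_sub_cancel_left, norm_neg, norm_smul,
    Real.norm_of_nonneg (Real.sqrt_nonneg _)]
  refine (mul_le_mul_of_nonneg_left (norm_integral_rpow_smul_le hd hb) (Real.sqrt_nonneg _)).trans
    (le_of_eq ?_)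
  field_simp

/-- Since `1 + (τ-e) R(e)` plays the role of `(S+τ) R(e)`, the defect is formally `R(e) ((S+τ) Q_τ²
- 1)`. This form makes sense without the unbounded `S`. Its derivative vanishes because `(1 + (τ-e)
R(e)) R(τ) = R(e)`. -/
theorem hasDerivAt_square_defect {e τ : ℝ} (he : 0 < e) (hτ : 0 < τ) :
    HasDerivAt (fun τ => (1 + (τ - e) • R e) * (sqrtInv R τ * sqrtInv R τ) - R e) 0 τ := by
  have h1 : HasDerivAt (fun τ : ℝ => 1 + (τ - e) • R e) (R e) τ := by
    have := (((hasDerivAt_id τ).sub_const e).smul_const (R e)).const_add 1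
    simpa using this
  have h2 := hR.hasDerivAt_sqrtInv hτ
  refine ((h1.mul (h2.mul h2)).sub_const (R e)).congr_deriv ?_
  have h3 : -((1 / 2 : ℝ) • (R τ * sqrtInv R τ)) * sqrtInv R τ +
      sqrtInv R τ * -((1 / 2 : ℝ) • (R τ * sqrtInv R τ)) =
        -(R τ * (sqrtInv R τ * sqrtInv R τ)) := by
    have h4 : sqrtInv R τ * (R τ * sqrtInv R τ) = R τ * (sqrtInv R τ * sqrtInv R τ) := by
      rw [← mul_assoc, ← hR.mul_sqrtInv hτ hτ, mul_assoc]
    rw [neg_mul, mul_neg, smul_mul_assoc, mul_smul_comm, h4, mul_assoc]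
    module
  have h5 : (1 + (τ - e) • R e) * R τ = R e := by
    rw [add_mul, one_mul, smul_mul_assoc, ← hR.resolvent e τ he hτ]
    abel
  rw [h3, mul_neg, ← mul_assoc (1 + _), h5, Pi.mul_apply, add_neg_cancel]

/-- The defect is constant in `τ` and is `O(τ⁻¹)` at infinity, hence zero; at `τ = e` it is `Q_e² -
R(e)`. This avoids both a functional calculus and a double integral. -/
theorem sqrtInv_mul_self {e : ℝ} (he : 0 < e) : sqrtInv R e * sqrtInv R e = R e := by
  set W : ℝ → 𝔸 := fun τ => (1 + (τ - e) • R e) * (sqrtInv R τ * sqrtInv R τ) - R e with hW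
  have hWe : W e = sqrtInv R e * sqrtInv R e - R e := by simp [hW]
  have hconst : ∀ τ, e < τ → W e = W τ := fun τ hτ =>
    isOpen_Ioi.is_const_of_deriv_eq_zero (s := Ioi (0 : ℝ)) isPreconnected_Ioi
      (fun x hx => (hR.hasDerivAt_square_defect he hx).differentiableAt.differentiableWithinAt)
      (fun x hx => (hR.hasDerivAt_square_defect he hx).deriv) he (he.trans hτ)
  have hbound : ∀ τ, e < τ → ‖W e‖ ≤ 3 * τ⁻¹ := by
    intro τ hτ
    have hτ0 := he.trans hτ
    have hd : 0 ≤ τ - e := (sub_pos.2 hτ).le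
    have hQ := hR.norm_sqrtInv_le hτ0
    have hD := hR.norm_sqrt_smul_sqrtInv_mul_sub_le he hτ
    set Q := sqrtInv R τ with hQdef
    -- With `D = √(τ-e) Q R(e) - R(e)`, the defect is `Q² + √(τ-e) Q D + D`. Here `‖Q²‖` and `‖D‖`
    -- are at most `τ⁻¹`, and `√(τ-e) Q` is a contraction.
    have hsplit : W τ = Q * Q + (√(τ - e) • Q) * (√(τ - e) • (Q * R e) - R e) +
        (√(τ - e) • (Q * R e) - R e) := by
      have h1 : R e * (Q * Q) = Q * (Q * R e) := by
        rw [← mul_assoc, hR.mul_sqrtInv he hτ0, mul_assoc, hR.mul_sqrtInv he hτ0]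
      simp only [hW, ← hQdef]
      rw [add_mul, one_mul, smul_mul_assoc, h1, mul_sub, smul_mul_smul_comm, Real.mul_self_sqrt hd,
        smul_mul_assoc]
      abel
    have h2 : ‖Q * Q‖ ≤ τ⁻¹ := by
      refine (norm_mul_le _ _).trans ((mul_le_mul hQ hQ (norm_nonneg _) (by positivity)).trans ?_)
      rw [← mul_inv, Real.mul_self_sqrt hτ0.le]
    have h3 : ‖√(τ - e) • Q‖ ≤ 1 := by
      rw [norm_smul, Real.norm_of_nonneg (Real.sqrt_nonneg _)]
      calc √(τ - e) * ‖Q‖ ≤ √τ * (√τ)⁻¹ := by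
            gcongr
            linarith
        _ = 1 := mul_inv_cancel₀ (Real.sqrt_pos.2 hτ0).ne'
    have h4 : ‖(√(τ - e) • Q) * (√(τ - e) • (Q * R e) - R e)‖ ≤ 1 * τ⁻¹ :=
      (norm_mul_le _ _).trans (mul_le_mul h3 hD (norm_nonneg _) zero_le_one)
    rw [hconst τ hτ, hsplit]
    refine (norm_add₃_le).trans ?_
    linarith
  have hlim : Tendsto (fun τ : ℝ => 3 * τ⁻¹) atTop (𝓝 0) := by
    simpa using tendsto_inv_atTop_zero.const_mul (3 : ℝ)
  have h0 : ‖W e‖ ≤ 0 := ge_of_tendsto hlim <| by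
    filter_upwards [eventually_gt_atTop e] with τ hτ using hbound τ hτ
  rw [norm_le_zero_iff, hWe] at h0
  exact sub_eq_zero.1 h0

end IsResolventFamily

end ResolventFamily

/-! ### Resolvents of unbounded operators and of their adjoints. -/

section Resolvents

variable {H : Type*} [NormedAddCommGroup H] [InnerProductSpace ℂ H]

theorem addScalar_apply (T : H →ₗ.[ℂ] H) (ζ : ℂ) (x : T.domain) :
    addScalar T ζ x = ζ • (x : H) + T x := rfl

theorem isInverseShift_addScalar {T : H →ₗ.[ℂ] H} {t ζ : ℂ} {R : H →L[ℂ] H} :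
    IsInverseShift (addScalar T t) ζ R ↔ IsInverseShift T (t + ζ) R := by
  constructor
  · rintro ⟨h1, h2⟩
    refine ⟨fun y => ?_, fun x => ?_⟩
    · obtain ⟨h, hy⟩ := h1 y
      refine ⟨h, ?_⟩
      have h3 : addScalar T t ⟨R y, h⟩ = t • R y + T ⟨R y, h⟩ := rfl
      rw [h3] at hy
      rw [add_smul, ← add_assoc, add_comm (T _)]
      exact hy
    · have h3 := h2 x
      rw [addScalar_apply] at h3
      rw [add_smul, ← add_assoc, add_comm (T _)]
      exact h3
  · rintro ⟨h1, h2⟩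
    refine ⟨fun y => ?_, fun (x : T.domain) => ?_⟩
    · obtain ⟨h, hy⟩ := h1 y
      refine ⟨h, ?_⟩
      have h3 : addScalar T t ⟨R y, h⟩ = t • R y + T ⟨R y, h⟩ := rfl
      rw [h3]
      rw [add_smul, ← add_assoc, add_comm (T _)] at hy
      exact hy
    · have h3 := h2 x
      change R (t • (x : H) + T x + ζ • (x : H)) = x
      rw [add_smul, ← add_assoc, add_comm (T _)] at h3
      exact h3

namespace IsInverseShift

variable {T : H →ₗ.[ℂ] H} {ζ : ℂ} {R R' : H →L[ℂ] H}

theorem unique (h : IsInverseShift T ζ R) (h' : IsInverseShift T ζ R') : R = R' := by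
  ext y
  obtain ⟨hy, hy'⟩ := h'.1 y
  conv_lhs => rw [← hy']
  exact h.2 ⟨R' y, hy⟩

theorem inverseShift_eq (h : IsInverseShift T ζ R) : inverseShift T ζ = R := by
  have hex : ∃ R, IsInverseShift T ζ R := ⟨R, h⟩
  rw [inverseShift, dif_pos hex]
  exact hex.choose_spec.unique h

theorem isInverseShift_inverseShift (h : IsInverseShift T ζ R) :
    IsInverseShift T ζ (inverseShift T ζ) := by
  rwa [h.inverseShift_eq]

theorem injective (h : IsInverseShift T ζ R) : Function.Injective R := by
  refine (injective_iff_map_eq_zero R).2 fun y hy => ?_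
  obtain ⟨hd, hy'⟩ := h.1 y
  have h0 : (⟨R y, hd⟩ : T.domain) = 0 := Subtype.ext hy
  rw [h0, hy, LinearPMap.map_zero, smul_zero, add_zero] at hy'
  exact hy'.symm

theorem range_eq (h : IsInverseShift T ζ R) : Set.range R = T.domain := by
  ext x
  constructor
  · rintro ⟨y, rfl⟩
    exact (h.1 y).1
  · intro hx
    exact ⟨_, h.2 ⟨x, hx⟩⟩

theorem apply_map (h : IsInverseShift T ζ R) (x : T.domain) : R (T x) = x - ζ • R x := by
  rw [eq_sub_iff_add_eq, ← map_smul, ← map_add]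
  exact h.2 x

/-- An operator with a bounded resolvent is closed. -/
theorem isClosed (h : IsInverseShift T ζ R) : T.IsClosed := by
  have hg : (T.graph : Set (H × H)) = {p | R (p.2 + ζ • p.1) = p.1} := by
    ext ⟨x, y⟩
    rw [SetLike.mem_coe, LinearPMap.mem_graph_iff]
    constructor
    · rintro ⟨x', hx, hy⟩
      change R (y + ζ • x) = x
      simp only at hx hy
      rw [← hx, ← hy]
      exact h.2 x'
    · intro hR
      change R (y + ζ • x) = x at hR
      obtain ⟨hd, hy⟩ := h.1 (y + ζ • x)
      have hx : x ∈ T.domain := hR ▸ hd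
      refine ⟨⟨x, hx⟩, rfl, ?_⟩
      have h1 : (⟨R (y + ζ • x), hd⟩ : T.domain) = ⟨x, hx⟩ := Subtype.ext hR
      rw [h1, hR] at hy
      exact add_right_cancel hy
  rw [LinearPMap.IsClosed, hg]
  exact isClosed_eq (by fun_prop) (by fun_prop)

/-- The resolvent of the adjoint is the adjoint of the resolvent. -/
theorem adjoint [CompleteSpace H] (h : IsInverseShift T ζ R) (hT : Dense (T.domain : Set H)) :
    IsInverseShift (T†) (starRingEnd ℂ ζ) (ContinuousLinearMap.adjoint R) := by
  constructor
  · intro y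
    have key : ∀ x : T.domain, ⟪y - starRingEnd ℂ ζ • ContinuousLinearMap.adjoint R y, (x : H)⟫_ℂ =
        ⟪ContinuousLinearMap.adjoint R y, T x⟫_ℂ := by
      intro x
      rw [ContinuousLinearMap.adjoint_inner_left, h.apply_map, inner_sub_left, inner_sub_right,
        inner_smul_left, inner_smul_right, ContinuousLinearMap.adjoint_inner_left,
        starRingEnd_self_apply]
    refine ⟨LinearPMap.mem_adjoint_domain_of_exists _ ⟨_, key⟩, ?_⟩
    rw [LinearPMap.adjoint_apply_eq hT _ key, sub_add_cancel]
  · intro x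
    refine ext_inner_right ℂ fun y => ?_
    obtain ⟨hd, hy⟩ := h.1 y
    have hfa := LinearPMap.adjoint_isFormalAdjoint hT x ⟨R y, hd⟩
    rw [ContinuousLinearMap.adjoint_inner_left, inner_add_left, inner_smul_left,
      starRingEnd_self_apply]
    conv_rhs => rw [← hy]
    rw [inner_add_right, inner_smul_right]
    congr 1

/-- The domain of the adjoint is the range of `R*`, whose orthogonal complement is the kernel of the
injective `R`. -/
theorem dense_adjoint_domain [CompleteSpace H] (h : IsInverseShift T ζ R)
    (hT : Dense (T.domain : Set H)) : Dense ((T†).domain : Set H) := by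
  rw [← (h.adjoint hT).range_eq]
  have h1 : ((ContinuousLinearMap.adjoint R).range)ᗮ = ⊥ := by
    rw [ContinuousLinearMap.orthogonal_range, ContinuousLinearMap.adjoint_adjoint]
    exact LinearMap.ker_eq_bot.2 h.injective
  exact Submodule.dense_iff_topologicalClosure_eq_top.2
    (Submodule.topologicalClosure_eq_top_iff.2 h1)

end IsInverseShift

/-- `R(s) = (S + s)⁻¹` with `‖R(s)‖ ≤ s⁻¹`, for all `s > 0`. -/
structure HasResolvent (S : H →ₗ.[ℂ] H) (R : ℝ → H →L[ℂ] H) : Prop where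
  isInverseShift : ∀ s : ℝ, 0 < s → IsInverseShift S ((s : ℝ) : ℂ) (R s)
  norm_le : ∀ s, 0 < s → ‖R s‖ ≤ s⁻¹

theorem IsMAccretive.hasResolvent {S : H →ₗ.[ℂ] H} (h : IsMAccretive S) :
    HasResolvent S (fun s => inverseShift S s) where
  isInverseShift s hs := by
    obtain ⟨R, hR, -⟩ := h s (by simpa using hs)
    exact hR.isInverseShift_inverseShift
  norm_le s hs := by
    obtain ⟨R, hR, hn⟩ := h s (by simpa using hs)
    rw [hR.inverseShift_eq]
    simpa using hn

namespace HasResolvent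

variable {S : H →ₗ.[ℂ] H} {R : ℝ → H →L[ℂ] H} (h : HasResolvent S R)
include h

theorem isResolventFamily : IsResolventFamily R where
  norm_le := h.norm_le
  resolvent s t hs ht := by
    ext y
    obtain ⟨hd, hy⟩ := (h.isInverseShift t ht).1 y
    have h1 := (h.isInverseShift s hs).2 ⟨R t y, hd⟩
    change R s y - R t y = ((t - s : ℝ)) • R s (R t y)
    have h2 : y = (S ⟨R t y, hd⟩ + (s : ℂ) • R t y) + ((t : ℂ) - s) • R t y := by
      rw [sub_smul]
      conv_lhs => rw [← hy]
      abel
    have h3 : R s y = R t y + ((t : ℂ) - s) • R s (R t y) := by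
      conv_lhs => rw [h2, map_add, h1, map_smul]
    rw [h3, add_sub_cancel_left, ← Complex.ofReal_sub, Complex.coe_smul]

theorem adjoint [CompleteSpace H] (hS : Dense (S.domain : Set H)) :
    HasResolvent (S†) (fun s => ContinuousLinearMap.adjoint (R s)) where
  isInverseShift s hs := by simpa using (h.isInverseShift s hs).adjoint hS
  norm_le s hs := by
    rw [LinearIsometryEquiv.norm_map]
    exact h.norm_le s hs

end HasResolvent

end Resolvents

/-! ### The domain of the Balakrishnan square root. -/

section SquareRoot

variable {H : Type*} [NormedAddCommGroup H] [InnerProductSpace ℂ H] [CompleteSpace H]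
variable {S : H →ₗ.[ℂ] H} {R : ℝ → H →L[ℂ] H}

/-- The bounded operator `S^{1/2} - (S + e)^{1/2}`. -/
noncomputable def sqrtShiftDiff (R : ℝ → H →L[ℂ] H) (e : ℝ) : H →L[ℂ] H :=
  Real.pi⁻¹ • ∫ s in Ioi (0 : ℝ), s ^ (-(1 / 2) : ℝ) • (s • (R (e + s) - R s))

namespace HasResolvent

variable (h : HasResolvent S R)
include h

/-- The difference of resolvents is `-e R(e+s) R(s)`, and the factor `s` cancels the singular bound
`‖R(s)‖ ≤ s⁻¹`. This makes the integral defining `sqrtShiftDiff` converge at `0`. -/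
theorem norm_smul_sub_le {e s : ℝ} (he : 0 < e) (hs : 0 < s) :
    ‖s • (R (e + s) - R s)‖ ≤ e * (e + s)⁻¹ := by
  have hes := add_pos he hs
  rw [h.isResolventFamily.resolvent (e + s) s hes hs, show s - (e + s) = -e by ring, norm_smul,
    norm_smul, norm_neg, Real.norm_of_nonneg hs.le, Real.norm_of_nonneg he.le]
  calc s * (e * ‖R (e + s) * R s‖) ≤ s * (e * ((e + s)⁻¹ * s⁻¹)) := by
        gcongr
        refine (norm_mul_le _ _).trans ?_
        gcongr
        · exact h.norm_le _ hes
        · exact h.norm_le _ hs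
    _ = e * (e + s)⁻¹ := by field_simp

omit [CompleteSpace H] in
theorem continuousOn : ContinuousOn R (Ioi 0) := fun _ hs =>
  (h.isResolventFamily.continuousAt hs).continuousWithinAt

omit [CompleteSpace H] in
theorem continuousOn_smul_sub {e : ℝ} (he : 0 < e) :
    ContinuousOn (fun s => s • (R (e + s) - R s)) (Ioi 0) :=
  continuousOn_id.smul ((h.isResolventFamily.continuousOn_add he).sub h.continuousOn)

theorem norm_sqrtShiftDiff_le {e : ℝ} (he : 0 < e) : ‖sqrtShiftDiff R e‖ ≤ √e := by
  refine (norm_integral_rpow_smul_le he fun s hs => h.norm_smul_sub_le he hs).trans (le_of_eq ?_)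
  rw [← div_eq_mul_inv, Real.div_sqrt]

omit [CompleteSpace H] in
-- Both `R(s) S x = x - s R(s) x` and `R(e+s) (S+e) x = x - s R(e+s) x` start with `x`; subtracting
-- them leaves `s (R(e+s) - R(s)) x`. The first summand integrates to `(S+e)^{-1/2} (S+e) x`, the
-- second to a bounded operator applied to `x`.
theorem sqrtIntegrand_eq {e s : ℝ} (he : 0 < e) (hs : 0 < s) (x : S.domain) :
    sqrtIntegrand S x s = (s ^ (-(1 / 2) : ℝ) • R (e + s)) (S x + (e : ℂ) • (x : H)) +
      (s ^ (-(1 / 2) : ℝ) • (s • (R (e + s) - R s))) (x : H) := by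
  have h1 : R s (S x) = x - (s : ℂ) • R s x := (h.isInverseShift s hs).apply_map x
  have h2 : R (e + s) (S x) = x - ((e + s : ℝ) : ℂ) • R (e + s) x :=
    (h.isInverseShift _ (add_pos he hs)).apply_map x
  rw [sqrtIntegrand, (h.isInverseShift s hs).inverseShift_eq]
  change _ = s ^ (-(1 / 2) : ℝ) • R (e + s) (S x + (e : ℂ) • (x : H)) +
    s ^ (-(1 / 2) : ℝ) • (s • (R (e + s) x - R s x))
  rw [← smul_add, map_add, map_smul, h1, h2, ← Complex.coe_smul s (_ - _), Complex.ofReal_add]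
  congr 1
  module

theorem integrableOn_sqrtIntegrand (x : S.domain) :
    IntegrableOn (sqrtIntegrand S x) (Ioi 0) := by
  have h1 := (h.isResolventFamily.integrableOn one_pos).apply_continuousLinearMap
    (S x + ((1 : ℝ) : ℂ) • (x : H))
  have h2 := (integrableOn_rpow_smul one_pos (h.continuousOn_smul_sub one_pos)
    fun s hs => h.norm_smul_sub_le one_pos hs).apply_continuousLinearMap (x : H)
  refine IntegrableOn.congr_fun (h1.add h2) (fun s hs => ?_) measurableSet_Ioi
  exact (h.sqrtIntegrand_eq one_pos hs x).symm

/-- On `dom S`, `S^{1/2} x = (S + e)^{-1/2} (S + e) x + Δ_e x`. -/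
theorem integral_sqrtIntegrand {e : ℝ} (he : 0 < e) (x : S.domain) :
    Real.pi⁻¹ • ∫ s in Ioi (0 : ℝ), sqrtIntegrand S x s =
      sqrtInv R e (S x + (e : ℂ) • (x : H)) + sqrtShiftDiff R e x := by
  have i1 := h.isResolventFamily.integrableOn he
  have i2 := integrableOn_rpow_smul he (h.continuousOn_smul_sub he)
    fun s hs => h.norm_smul_sub_le he hs
  rw [setIntegral_congr_fun measurableSet_Ioi fun s hs => h.sqrtIntegrand_eq he hs x,
    integral_add (i1.apply_continuousLinearMap _) (i2.apply_continuousLinearMap _),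
    ← ContinuousLinearMap.integral_apply i1, ← ContinuousLinearMap.integral_apply i2, smul_add]
  rfl

theorem mem_sqrtPreGraph_iff {e : ℝ} (he : 0 < e) {p : H × H} :
    p ∈ sqrtPreGraph S ↔ ∃ x : S.domain, (x : H) = p.1 ∧
      p.2 = sqrtInv R e (S x + (e : ℂ) • (x : H)) + sqrtShiftDiff R e x := by
  constructor
  · rintro ⟨x, hx, -, hp⟩
    exact ⟨x, hx, hp.trans (h.integral_sqrtIntegrand he x)⟩
  · rintro ⟨x, hx, hp⟩
    exact ⟨x, hx, h.integrableOn_sqrtIntegrand x, hp.trans (h.integral_sqrtIntegrand he x).symm⟩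

theorem sqrtInv_sqrtInv {e : ℝ} (he : 0 < e) (y : H) : sqrtInv R e (sqrtInv R e y) = R e y :=
  congrArg (fun L : H →L[ℂ] H => L y) (h.isResolventFamily.sqrtInv_mul_self he)

theorem sqrtInv_injective {e : ℝ} (he : 0 < e) : Function.Injective (sqrtInv R e : H →L[ℂ] H) := by
  intro y z hyz
  refine (h.isInverseShift e he).injective ?_
  rw [← h.sqrtInv_sqrtInv he, ← h.sqrtInv_sqrtInv he, hyz]

/-- The closure is the graph of `Q_e⁻¹ + Δ_e`, with `Q_e = sqrtInv R e` and `Δ_e = sqrtShiftDiff R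
e`. The condition is closed and holds on the pre-graph because `Q_e² (S+e) x = x`; the converse is a
density argument. -/
theorem mem_closure_sqrtPreGraph_iff (hS : Dense (S.domain : Set H)) {e : ℝ} (he : 0 < e)
    {p : H × H} : p ∈ (sqrtPreGraph S).topologicalClosure ↔
      sqrtInv R e (p.2 - sqrtShiftDiff R e p.1) = p.1 := by
  constructor
  · intro hp
    have hcl : IsClosed {p : H × H | sqrtInv R e (p.2 - sqrtShiftDiff R e p.1) = p.1} :=
      isClosed_eq (by fun_prop) (by fun_prop)
    refine closure_minimal (s := (sqrtPreGraph S : Set (H × H))) ?_ hcl hp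
    intro q hq
    obtain ⟨x, hx, hq2⟩ := (h.mem_sqrtPreGraph_iff he).1 hq
    change sqrtInv R e (q.2 - sqrtShiftDiff R e q.1) = q.1
    rw [hq2, ← hx, add_sub_cancel_right, h.sqrtInv_sqrtInv he]
    exact (h.isInverseShift e he).2 x
  · intro hp
    -- `f` parametrises the graph of `Q_e⁻¹ + Δ_e` by `y = Q_e⁻¹ x`. It sends the dense set `dom S`
    -- into the pre-graph, because `Q_e` commutes with `R(e)` and so preserves `dom S`.
    set f : H → H × H := fun y => (sqrtInv R e y, y + sqrtShiftDiff R e (sqrtInv R e y)) with hf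
    have hfc : Continuous f := by fun_prop
    have hpf : p = f (p.2 - sqrtShiftDiff R e p.1) := by
      simp only [hf, hp, sub_add_cancel]
    have hmaps : MapsTo f (S.domain : Set H) (sqrtPreGraph S : Set (H × H)) := by
      intro y hy
      rw [← (h.isInverseShift e he).range_eq] at hy
      obtain ⟨w, rfl⟩ := hy
      have hcomm : sqrtInv R e (R e w) = R e (sqrtInv R e w) :=
        congrArg (fun L : H →L[ℂ] H => L w) (h.isResolventFamily.mul_sqrtInv he he).symm
      obtain ⟨hd, hw⟩ := (h.isInverseShift e he).1 (sqrtInv R e w)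
      refine (h.mem_sqrtPreGraph_iff he).2 ⟨⟨R e (sqrtInv R e w), hd⟩, hcomm.symm, ?_⟩
      rw [hw, h.sqrtInv_sqrtInv he]
      simp only [hf, hcomm]
    rw [hpf]
    exact map_mem_closure hfc (hS _) hmaps

/-- A bounded summand does not change the domain of `Q_e⁻¹ + Δ_e`. Since `e` is arbitrary, a range
computation may use only resolvents at points as large as needed. -/
theorem sqrtOp_domain (hS : Dense (S.domain : Set H)) {e : ℝ} (he : 0 < e) :
    (sqrtOp S).domain = (sqrtInv R e : H →L[ℂ] H).range := by
  ext x
  rw [sqrtOp, Submodule.toLinearPMap_domain, Submodule.mem_map]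
  constructor
  · rintro ⟨p, hp, rfl⟩
    exact ⟨_, (h.mem_closure_sqrtPreGraph_iff hS he).1 hp⟩
  · rintro ⟨y, rfl⟩
    refine ⟨(sqrtInv R e y, y + sqrtShiftDiff R e (sqrtInv R e y)), ?_, rfl⟩
    rw [h.mem_closure_sqrtPreGraph_iff hS he, add_sub_cancel_right]

theorem sqrtInv_sqrtOp_sub (hS : Dense (S.domain : Set H)) {e : ℝ} (he : 0 < e)
    (x : (sqrtOp S).domain) :
    sqrtInv R e (sqrtOp S x - sqrtShiftDiff R e x) = x := by
  refine (h.mem_closure_sqrtPreGraph_iff hS he).1 (Submodule.mem_graph_toLinearPMap ?_ x)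
  -- Single-valuedness of the closed graph, from the injectivity of `Q_e`.
  intro p hp hp0
  have h1 := (h.mem_closure_sqrtPreGraph_iff hS he).1 hp
  rw [hp0, map_zero, sub_zero] at h1
  exact h.sqrtInv_injective he (h1.trans (map_zero _).symm)

end HasResolvent

end SquareRoot

/-! ### Factorisation through an embedding, and comparison of ranges. -/

section ClosedGraph

variable {H K : Type*} [NormedAddCommGroup H] [InnerProductSpace ℂ H] [CompleteSpace H]
  [NormedAddCommGroup K] [InnerProductSpace ℂ K] [CompleteSpace K]

/-- An operator whose range lies in the range of an injective bounded operator `J` factors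
through `J`. -/
theorem ContinuousLinearMap.exists_comp_eq_of_range_le {J : K →L[ℂ] H} (hJ : Function.Injective J)
    {T : H →L[ℂ] H} (hT : T.range ≤ J.range) : ∃ G : H →L[ℂ] K, J ∘L G = T := by
  choose g hg using fun x : H => hT ⟨x, rfl⟩
  have hg' : ∀ x, J (g x) = T x := hg
  let g' : H →ₗ[ℂ] K :=
    { toFun := g
      map_add' := fun x y => hJ (by simp [hg'])
      map_smul' := fun c x => hJ (by simp [hg']) }
  have hc : Continuous g' := g'.continuous_of_seq_closed_graph fun u x y hu hy => by
    refine hJ (tendsto_nhds_unique ((J.continuous.tendsto y).comp hy) ?_)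
    have h1 : (J ∘ g' ∘ u) = T ∘ u := by
      funext n
      exact hg' (u n)
    rw [h1]
    exact (hg' x) ▸ (T.continuous.tendsto x).comp hu
  exact ⟨⟨g', hc⟩, ContinuousLinearMap.ext hg'⟩

theorem ContinuousLinearMap.denseRange_adjoint {J : K →L[ℂ] H} (hJ : Function.Injective J) :
    DenseRange (ContinuousLinearMap.adjoint J) := by
  have h1 : ((ContinuousLinearMap.adjoint J).range)ᗮ = ⊥ := by
    rw [ContinuousLinearMap.orthogonal_range, ContinuousLinearMap.adjoint_adjoint]
    exact LinearMap.ker_eq_bot.2 hJ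
  exact Submodule.dense_iff_topologicalClosure_eq_top.2
    (Submodule.topologicalClosure_eq_top_iff.2 h1)

/-- If `Q² = J X J*` with `X` invertible and `Q*` maps into the range of `J`, then the range of `J`
lies in the range of `Q`. -/
theorem range_le_range_of_adjoint_range_le {J : K →L[ℂ] H} (hJ : Function.Injective J)
    {Q : H →L[ℂ] H} {X X' : K →L[ℂ] K} (hX : X * X' = 1)
    (hQ : Q * Q = J ∘L X ∘L ContinuousLinearMap.adjoint J)
    (hr : (ContinuousLinearMap.adjoint Q).range ≤ J.range) : J.range ≤ Q.range := by
  obtain ⟨G, hG⟩ := ContinuousLinearMap.exists_comp_eq_of_range_le hJ hr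
  have hQ' : Q = ContinuousLinearMap.adjoint G ∘L ContinuousLinearMap.adjoint J := by
    rw [← ContinuousLinearMap.adjoint_comp, hG, ContinuousLinearMap.adjoint_adjoint]
  -- On vectors `w = J* y` this is `Q² = J X J*`, since `Q = G* J*`. The range of `J*` is dense
  -- because `J` is injective.
  have h1 : ∀ w : K, Q (ContinuousLinearMap.adjoint G w) = J (X w) := by
    intro w
    refine congrFun ((ContinuousLinearMap.denseRange_adjoint hJ).equalizer
      (g := fun w => Q (ContinuousLinearMap.adjoint G w)) (h := fun w => J (X w))
      (by fun_prop) (by fun_prop) ?_) w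
    funext y
    have h2 : Q (Q y) = J (X (ContinuousLinearMap.adjoint J y)) :=
      congrArg (fun L : H →L[ℂ] H => L y) hQ
    have h3 : Q y = ContinuousLinearMap.adjoint G (ContinuousLinearMap.adjoint J y) :=
      congrArg (fun L : H →L[ℂ] H => L y) hQ'
    change Q (ContinuousLinearMap.adjoint G (ContinuousLinearMap.adjoint J y)) = _
    rw [← h3, h2]
    rfl
  rintro _ ⟨u, rfl⟩
  refine ⟨ContinuousLinearMap.adjoint G (X' u), ?_⟩
  have h4 : X (X' u) = u := congrArg (fun L : K →L[ℂ] K => L u) hX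
  exact (h1 _).trans (congrArg J h4)

theorem adjoint_sqrtInv {R : ℝ → H →L[ℂ] H} {e : ℝ} :
    ContinuousLinearMap.adjoint (sqrtInv R e) =
      sqrtInv (fun s => ContinuousLinearMap.adjoint (R s)) e := by
  -- The adjoint is conjugate-linear over `ℂ`; it is taken as a real-linear continuous map so that
  -- it commutes with the integral.
  have h1 : ∀ T : H →L[ℂ] H, ContinuousLinearMap.adjoint T = starL' ℝ T := fun _ => rfl
  simp only [sqrtInv, h1, map_smul]
  rw [← ContinuousLinearEquiv.integral_comp_comm]
  simp only [map_smul]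

end ClosedGraph

/-! ### Operators of coercive forms: resolvents, m-accretivity, sectoriality. -/

section FormOperators

variable {H K : Type*} [NormedAddCommGroup H] [InnerProductSpace ℂ H] [CompleteSpace H]
  [NormedAddCommGroup K] [InnerProductSpace ℂ K] [CompleteSpace K]

/-- The operator of the form `⟪w, A u⟫ + z ⟪J w, J u⟫`. -/
noncomputable def shiftedForm (J : K →L[ℂ] H) (A : K →L[ℂ] K) (z : ℂ) : K →L[ℂ] K :=
  A + z • (ContinuousLinearMap.adjoint J ∘L J)

/-- `J (A + z J* J)⁻¹ J*`: the resolvent at `-z` of the operator in `H` associated with the form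
`⟪w, A u⟫` on the form domain `K`, embedded in `H` by `J`. -/
noncomputable def formResolvent (J : K →L[ℂ] H) (A : K →L[ℂ] K) (z : ℂ) : H →L[ℂ] H :=
  J ∘L Ring.inverse (shiftedForm J A z) ∘L ContinuousLinearMap.adjoint J

/-- The form `Re ⟪u, A u⟫ + r ‖J u‖²` is bounded below by `c ‖u‖²`. -/
def QuasiCoercive (J : K →L[ℂ] H) (A : K →L[ℂ] K) (c r : ℝ) : Prop :=
  ∀ u : K, c * ‖u‖ ^ 2 ≤ (⟪u, A u⟫_ℂ).re + r * ‖J u‖ ^ 2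

variable {J : K →L[ℂ] H} {A : K →L[ℂ] K} {c r : ℝ} {z : ℂ}

theorem inner_shiftedForm (w u : K) :
    ⟪w, shiftedForm J A z u⟫_ℂ = ⟪w, A u⟫_ℂ + z * ⟪J w, J u⟫_ℂ := by
  change ⟪w, A u + z • ContinuousLinearMap.adjoint J (J u)⟫_ℂ = _
  rw [inner_add_right, inner_smul_right, ContinuousLinearMap.adjoint_inner_right]

theorem re_inner_shiftedForm (u : K) :
    (⟪u, shiftedForm J A z u⟫_ℂ).re = (⟪u, A u⟫_ℂ).re + z.re * ‖J u‖ ^ 2 := by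
  rw [inner_shiftedForm, inner_self_eq_norm_sq_to_K, Complex.add_re]
  congr 1
  simp [← Complex.ofReal_pow]

theorem adjoint_shiftedForm : ContinuousLinearMap.adjoint (shiftedForm J A z) =
    shiftedForm J (ContinuousLinearMap.adjoint A) (starRingEnd ℂ z) := by
  rw [shiftedForm, shiftedForm, map_add, map_smulₛₗ, ContinuousLinearMap.adjoint_comp,
    ContinuousLinearMap.adjoint_adjoint]

theorem adjoint_formResolvent : ContinuousLinearMap.adjoint (formResolvent J A z) =
    formResolvent J (ContinuousLinearMap.adjoint A) (starRingEnd ℂ z) := by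
  rw [formResolvent, formResolvent, ContinuousLinearMap.adjoint_comp,
    ContinuousLinearMap.adjoint_comp, ContinuousLinearMap.adjoint_adjoint, ← adjoint_shiftedForm,
    ← ContinuousLinearMap.star_eq_adjoint, ← ContinuousLinearMap.star_eq_adjoint (shiftedForm J A z),
    Ring.inverse_star]
  rfl

theorem isUnit_of_coercive {B : K →L[ℂ] K} (hc : 0 < c)
    (h : ∀ u, c * ‖u‖ ^ 2 ≤ (⟪u, B u⟫_ℂ).re) : IsUnit B := by
  refine ContinuousLinearMap.isUnit_of_forall_le_norm_inner_map B (c := ⟨c, hc.le⟩) hc fun u => ?_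
  rw [mul_comm, norm_inner_symm]
  exact (h u).trans (Complex.re_le_norm _)

namespace QuasiCoercive

omit [CompleteSpace H] [CompleteSpace K] in
theorem mono {r' : ℝ} (h : QuasiCoercive J A c r) (hr : r ≤ r') : QuasiCoercive J A c r' :=
  fun u => (h u).trans (by gcongr)

omit [CompleteSpace H] in
theorem adjoint (h : QuasiCoercive J A c r) :
    QuasiCoercive J (ContinuousLinearMap.adjoint A) c r := by
  intro u
  rw [ContinuousLinearMap.adjoint_inner_right, ← inner_conj_symm, Complex.conj_re]
  exact h u

theorem le_re_inner_shiftedForm (h : QuasiCoercive J A c r) (u : K) :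
    c * ‖u‖ ^ 2 + (z.re - r) * ‖J u‖ ^ 2 ≤ (⟪u, shiftedForm J A z u⟫_ℂ).re := by
  rw [re_inner_shiftedForm]
  linarith [h u]

theorem isUnit (h : QuasiCoercive J A c r) (hc : 0 < c) (hz : r ≤ z.re) :
    IsUnit (shiftedForm J A z) := by
  refine isUnit_of_coercive hc fun u => le_trans ?_ (h.le_re_inner_shiftedForm u)
  have : 0 ≤ (z.re - r) * ‖J u‖ ^ 2 := mul_nonneg (sub_nonneg.2 hz) (sq_nonneg _)
  linarith

end QuasiCoercive

theorem shiftedForm_inverse_apply (hu : IsUnit (shiftedForm J A z)) (w : K) :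
    shiftedForm J A z (Ring.inverse (shiftedForm J A z) w) = w :=
  congrArg (fun L : K →L[ℂ] K => L w) (Ring.mul_inverse_cancel _ hu)

theorem inverse_shiftedForm_apply (hu : IsUnit (shiftedForm J A z)) (w : K) :
    Ring.inverse (shiftedForm J A z) (shiftedForm J A z w) = w :=
  congrArg (fun L : K →L[ℂ] K => L w) (Ring.inverse_mul_cancel _ hu)

/-- The energy estimate: the equation `(A + z J*J) u = J* y` is tested against `u`. It controls the
norm of `u` in `K` and that of `J u` in `H` at once. -/
theorem QuasiCoercive.re_inner_resolvent_le (h : QuasiCoercive J A c r) (hc : 0 < c)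
    (hz : r ≤ z.re) (y : H) :
    c * ‖Ring.inverse (shiftedForm J A z) (ContinuousLinearMap.adjoint J y)‖ ^ 2 +
      (z.re - r) * ‖formResolvent J A z y‖ ^ 2 ≤ ‖formResolvent J A z y‖ * ‖y‖ := by
  have h1 := h.le_re_inner_shiftedForm (z := z)
    (Ring.inverse (shiftedForm J A z) (ContinuousLinearMap.adjoint J y))
  rw [shiftedForm_inverse_apply (h.isUnit hc hz), ContinuousLinearMap.adjoint_inner_right] at h1
  exact h1.trans ((Complex.re_le_norm _).trans (norm_inner_le_norm _ _))

/-- The form `q` is `⟪w, A u⟫` in terms of the embedding `J` of its domain, a Hilbert space. -/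
structure SesqForm.IsRepresentedBy (q : SesqForm H) (J : K →L[ℂ] H) (A : K →L[ℂ] K) : Prop where
  injective : Function.Injective J
  denseRange : DenseRange J
  range_eq : J.range = q.domain
  form_eq : ∀ (w u : K) (hw : J w ∈ q.domain) (hu : J u ∈ q.domain),
    q.form ⟨J w, hw⟩ ⟨J u, hu⟩ = ⟪w, A u⟫_ℂ

namespace SesqForm.IsRepresentedBy

variable {q : SesqForm H} (hq : q.IsRepresentedBy J A)
include hq

omit [CompleteSpace H] [CompleteSpace K] in
theorem mem_domain (u : K) : J u ∈ q.domain := hq.range_eq ▸ ⟨u, rfl⟩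

theorem mem_operatorGraph_iff {p : H × H} :
    p ∈ q.operatorGraph ↔ ∃ u : K, J u = p.1 ∧ A u = ContinuousLinearMap.adjoint J p.2 := by
  constructor
  · rintro ⟨u, hu, h⟩
    obtain ⟨u', hu'⟩ : (u : H) ∈ J.range := by rw [hq.range_eq]; exact u.2
    have hu'' : J u' = u := hu'
    refine ⟨u', hu''.trans hu, ext_inner_left ℂ fun w => ?_⟩
    rw [ContinuousLinearMap.adjoint_inner_right, ← hq.form_eq w u' (hq.mem_domain w)
      (hq.mem_domain u'), ← h ⟨J w, hq.mem_domain w⟩]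
    congr 2
  · rintro ⟨u, hu, h⟩
    refine ⟨⟨J u, hq.mem_domain u⟩, hu, fun w => ?_⟩
    obtain ⟨w', hw'⟩ : (w : H) ∈ J.range := by rw [hq.range_eq]; exact w.2
    have hw : w = ⟨J w', hq.mem_domain w'⟩ := Subtype.ext hw'.symm
    rw [hw, hq.form_eq, h, ContinuousLinearMap.adjoint_inner_right]

/-- The relation defining the operator is single-valued: for `u = 0` the equation says that the
value is orthogonal to the dense range of `J`. -/
theorem mem_operator_graph_iff {p : H × H} :
    p ∈ q.operator.graph ↔ ∃ u : K, J u = p.1 ∧ A u = ContinuousLinearMap.adjoint J p.2 := by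
  rw [← hq.mem_operatorGraph_iff, SesqForm.operator, Submodule.toLinearPMap_graph_eq]
  intro p hp hp0
  obtain ⟨u, hu, h⟩ := hq.mem_operatorGraph_iff.1 hp
  have hu0 : u = 0 := hq.injective (by rw [hu, hp0, map_zero])
  rw [hu0, map_zero] at h
  refine hq.denseRange.eq_zero_of_inner_right ℂ fun y => ?_
  rw [← ContinuousLinearMap.adjoint_inner_right, ← h, inner_zero_right]

theorem isInverseShift (hu : IsUnit (shiftedForm J A z)) :
    IsInverseShift q.operator z (formResolvent J A z) := by
  constructor
  · intro y
    have h1 : (formResolvent J A z y, y - z • formResolvent J A z y) ∈ q.operator.graph := by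
      refine hq.mem_operator_graph_iff.2
        ⟨Ring.inverse (shiftedForm J A z) (ContinuousLinearMap.adjoint J y), rfl, ?_⟩
      have h2 := shiftedForm_inverse_apply hu (ContinuousLinearMap.adjoint J y)
      rw [map_sub, eq_sub_iff_add_eq, map_smul]
      exact h2
    obtain ⟨x, hx, hy⟩ := (LinearPMap.mem_graph_iff _).1 h1
    have hx' : (x : H) = formResolvent J A z y := hx
    have hd : formResolvent J A z y ∈ q.operator.domain := hx' ▸ x.2
    have hxe : (⟨formResolvent J A z y, hd⟩ : q.operator.domain) = x := Subtype.ext hx'.symm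
    refine ⟨hd, ?_⟩
    rw [hxe, hy, sub_add_cancel]
  · intro x
    obtain ⟨u, hu1, hu2⟩ := hq.mem_operator_graph_iff.1 (q.operator.mem_graph x)
    simp only at hu1 hu2
    have h1 : shiftedForm J A z u = ContinuousLinearMap.adjoint J (q.operator x + z • (x : H)) := by
      rw [map_add, ← hu2, map_smul, ← hu1]
      rfl
    change J (Ring.inverse (shiftedForm J A z) (ContinuousLinearMap.adjoint J _)) = _
    rw [← h1, inverse_shiftedForm_apply hu, hu1]

/-- The domain is the image of `H` under `J (A + z J*J)⁻¹ J*`, a composition of maps with dense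
range. -/
theorem dense_domain (hu : IsUnit (shiftedForm J A z)) :
    Dense (q.operator.domain : Set H) := by
  rw [← (hq.isInverseShift hu).range_eq]
  have h1 : Function.Surjective (Ring.inverse (shiftedForm J A z) : K →L[ℂ] K) := fun w =>
    ⟨_, inverse_shiftedForm_apply hu w⟩
  exact hq.denseRange.comp (h1.denseRange.comp
    (ContinuousLinearMap.denseRange_adjoint hq.injective) (ContinuousLinearMap.continuous _))
    J.continuous

/-- Forms that are coercive after every shift by more than `t` have resolvents with the m-accretive
bound. -/
theorem isInverseShift_and_norm_le {t : ℝ}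
    (h : ∀ r : ℝ, t < r → ∃ c, 0 < c ∧ QuasiCoercive J A c r) (hz : t < z.re) :
    IsInverseShift q.operator z (formResolvent J A z) ∧ ‖formResolvent J A z‖ ≤ (z.re - t)⁻¹ := by
  obtain ⟨c, hc, hcr⟩ := h z.re hz
  refine ⟨hq.isInverseShift (hcr.isUnit hc le_rfl), ?_⟩
  refine ContinuousLinearMap.opNorm_le_bound _ (inv_nonneg.2 (sub_nonneg.2 hz.le)) fun y => ?_
  -- Coercivity is available only for `r > t`, with a constant that may degenerate as `r → t`. That
  -- constant is discarded, after which the limit `r → t` gives the sharp factor `Re z - t`.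
  have h1 : ∀ r, t < r → r < z.re →
      (z.re - r) * ‖formResolvent J A z y‖ ^ 2 ≤ ‖formResolvent J A z y‖ * ‖y‖ := by
    intro r hr hrz
    obtain ⟨c', hc', hcr'⟩ := h r hr
    refine le_trans ?_ (hcr'.re_inner_resolvent_le hc' hrz.le y)
    have : 0 ≤ c' * ‖Ring.inverse (shiftedForm J A z) (ContinuousLinearMap.adjoint J y)‖ ^ 2 := by
      positivity
    linarith
  have h2 : (z.re - t) * ‖formResolvent J A z y‖ ^ 2 ≤ ‖formResolvent J A z y‖ * ‖y‖ := by
    have hl : Filter.Tendsto (fun r : ℝ => (z.re - r) * ‖formResolvent J A z y‖ ^ 2) (𝓝[>] t)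
        (𝓝 ((z.re - t) * ‖formResolvent J A z y‖ ^ 2)) := by
      have : Continuous (fun r : ℝ => (z.re - r) * ‖formResolvent J A z y‖ ^ 2) := by fun_prop
      exact (this.tendsto t).mono_left nhdsWithin_le_nhds
    refine le_of_tendsto hl ?_
    filter_upwards [Ioo_mem_nhdsGT hz] with r hr using h1 r hr.1 hr.2
  rw [inv_mul_eq_div, le_div_iff₀ (sub_pos.2 hz)]
  rcases eq_or_lt_of_le (norm_nonneg (formResolvent J A z y)) with h0 | h0
  · rw [← h0, zero_mul]
    exact norm_nonneg y
  · nlinarith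

theorem hasResolvent (h : ∀ r : ℝ, 0 < r → ∃ c, 0 < c ∧ QuasiCoercive J A c r) :
    HasResolvent q.operator (fun s => formResolvent J A s) where
  isInverseShift s hs := (hq.isInverseShift_and_norm_le h (z := s) (by simpa using hs)).1
  norm_le s hs := by
    simpa using (hq.isInverseShift_and_norm_le h (z := s) (by simpa using hs)).2

theorem isMAccretive_addScalar {t : ℝ}
    (h : ∀ r : ℝ, t < r → ∃ c, 0 < c ∧ QuasiCoercive J A c r) :
    IsMAccretive (addScalar q.operator t) := by
  intro ζ hζ
  have h1 := hq.isInverseShift_and_norm_le h (z := t + ζ) (by simpa using hζ)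
  refine ⟨_, isInverseShift_addScalar.2 h1.1, ?_⟩
  simpa using h1.2

end SesqForm.IsRepresentedBy

theorem abs_arg_le_arctan {w : ℂ} {C : ℝ} (hre : 0 < w.re) (h : |w.im| ≤ C * w.re) :
    |Complex.arg w| ≤ Real.arctan C := by
  have h1 : Complex.arg w = Real.arctan (w.im / w.re) := by
    rw [← Complex.tan_arg, Real.arctan_tan]
    · exact (abs_lt.1 (Complex.abs_arg_lt_pi_div_two_iff.2 (Or.inl hre))).1
    · exact (abs_lt.1 (Complex.abs_arg_lt_pi_div_two_iff.2 (Or.inl hre))).2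
  have h2 := abs_le.1 h
  rw [h1, abs_le, ← Real.arctan_neg]
  constructor
  · refine Real.arctan_strictMono.monotone ?_
    rw [le_div_iff₀ hre]
    linarith
  · refine Real.arctan_strictMono.monotone ?_
    rw [div_le_iff₀ hre]
    linarith

/-- For a unit vector `x = J u`, the shifted real part is at least `c ‖u‖²` and the imaginary part
is at most `‖A‖ ‖u‖²`. Hence the sector has vertex `-r` and slope `‖A‖ / c`. -/
theorem SesqForm.IsRepresentedBy.isMSectorial {q : SesqForm H} (hq : q.IsRepresentedBy J A)
    (hc : 0 < c) (h : QuasiCoercive J A c r) : IsMSectorial q.operator := by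
  have hu : IsUnit (shiftedForm J A r) := h.isUnit hc (by simp)
  refine ⟨(hq.isInverseShift hu).isClosed, hq.dense_domain hu,
    ⟨r, hq.isMAccretive_addScalar fun r' hr => ⟨c, hc, h.mono hr.le⟩⟩,
    -r, Real.arctan (‖A‖ / c), Real.arctan_nonneg.2 (by positivity), Real.arctan_lt_pi_div_two _,
    fun x hx => ?_⟩
  obtain ⟨u, hu1, hu2⟩ := hq.mem_operator_graph_iff.1 (q.operator.mem_graph x)
  simp only at hu1 hu2
  have h1 : ⟪(x : H), q.operator x⟫_ℂ = ⟪u, A u⟫_ℂ := by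
    rw [hu2, ContinuousLinearMap.adjoint_inner_right, hu1]
  have hu0 : 0 < ‖u‖ := by
    refine norm_pos_iff.2 fun h0 => ?_
    rw [h0, map_zero] at hu1
    rw [← hu1, norm_zero] at hx
    exact zero_ne_one hx
  have h2 := h u
  rw [hu1, hx] at h2
  have h3 : |(⟪u, A u⟫_ℂ).im| ≤ ‖A‖ * ‖u‖ ^ 2 := by
    refine (Complex.abs_im_le_norm _).trans ((norm_inner_le_norm _ _).trans ?_)
    nlinarith [A.le_opNorm u]
  rw [h1]
  have h4 : (⟪u, A u⟫_ℂ - ((-r : ℝ) : ℂ)).re = (⟪u, A u⟫_ℂ).re + r := by simp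
  have h5 : (⟪u, A u⟫_ℂ - ((-r : ℝ) : ℂ)).im = (⟪u, A u⟫_ℂ).im := by simp
  refine abs_arg_le_arctan ?_ ?_
  · rw [h4]
    nlinarith [mul_pos hc (pow_pos hu0 2)]
  · rw [h4, h5, div_mul_eq_mul_div, le_div_iff₀ hc]
    nlinarith [mul_le_mul_of_nonneg_left h2 (norm_nonneg A), mul_le_mul_of_nonneg_right h3 hc.le]

end FormOperators

/-! ### Perturbation of the inverse square root under a polynomial form bound. -/

section Perturbation

theorem integrableOn_rpow_neg_half_mul_rpow {δ : ℝ} (hδ : 0 < δ) :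
    IntegrableOn (fun s : ℝ => s ^ (-(1 / 2) : ℝ) * (1 + s) ^ (-(1 / 2) - δ : ℝ)) (Ioi 0) := by
  have hcont : ContinuousOn (fun s : ℝ => s ^ (-(1 / 2) : ℝ) * (1 + s) ^ (-(1 / 2) - δ : ℝ))
      (Ioi 0) := by
    refine continuousOn_rpow_neg_half.mul (ContinuousOn.rpow_const (by fun_prop) fun s hs => ?_)
    have : (0 : ℝ) < s := hs
    exact Or.inl (by positivity)
  rw [← Ioc_union_Ioi_eq_Ioi zero_le_one]
  refine IntegrableOn.union ?_ ?_
  · have h1 : IntegrableOn (fun s : ℝ => s ^ (-(1 / 2) : ℝ)) (Ioc 0 1) :=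
      (intervalIntegrable_iff_integrableOn_Ioc_of_le zero_le_one).1
        (intervalIntegral.intervalIntegrable_rpow' (by norm_num))
    refine h1.mono' ((hcont.mono Ioc_subset_Ioi_self).aestronglyMeasurable measurableSet_Ioc) ?_
    filter_upwards [ae_restrict_mem measurableSet_Ioc] with s hs
    have hs0 : 0 < s := hs.1
    rw [Real.norm_of_nonneg (by positivity)]
    refine mul_le_of_le_one_right (by positivity) ?_
    exact Real.rpow_le_one_of_one_le_of_nonpos (by linarith) (by linarith)
  · have h1 : IntegrableOn (fun s : ℝ => s ^ (-1 - δ : ℝ)) (Ioi 1) :=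
      integrableOn_Ioi_rpow_of_lt (by linarith) one_pos
    refine h1.mono' ((hcont.mono (Ioi_subset_Ioi zero_le_one)).aestronglyMeasurable
      measurableSet_Ioi) ?_
    filter_upwards [ae_restrict_mem measurableSet_Ioi] with s (hs : 1 < s)
    have hs0 : 0 < s := by linarith
    rw [Real.norm_of_nonneg (by positivity)]
    calc s ^ (-(1 / 2) : ℝ) * (1 + s) ^ (-(1 / 2) - δ : ℝ) ≤
          s ^ (-(1 / 2) : ℝ) * s ^ (-(1 / 2) - δ : ℝ) := by
          gcongr ?_ * ?_
          exact Real.rpow_le_rpow_of_nonpos hs0 (by linarith) (by linarith)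
      _ = s ^ (-1 - δ : ℝ) := by
        rw [← Real.rpow_add hs0]
        congr 1
        ring

variable {H K G : Type*} [NormedAddCommGroup H] [InnerProductSpace ℂ H] [CompleteSpace H]
  [NormedAddCommGroup K] [InnerProductSpace ℂ K] [CompleteSpace K]
  [NormedAddCommGroup G] [InnerProductSpace ℂ G] [CompleteSpace G]
variable {J : K →L[ℂ] H} {A A₀ : K →L[ℂ] K} {U V : K →L[ℂ] G} {c e : ℝ}

/-- `U` has relative form bounds that grow at most like a power `ε ^ (-β)`. -/
def HasPolynomialFormBound (J : K →L[ℂ] H) (U : K →L[ℂ] G) (M β ε₀ : ℝ) : Prop :=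
  ∀ ε : ℝ, 0 < ε → ε < ε₀ → ∀ u : K, ‖U u‖ ^ 2 ≤ ε * ‖u‖ ^ 2 + M * ε ^ (-β) * ‖J u‖ ^ 2

/-- Half of `c ‖u‖²` in the energy estimate is kept, and the other half is traded for `‖J u‖²`
through `‖J u‖ ≤ ‖u‖`. This replaces the weight `s` of `‖J u‖²` by a multiple of `1 + s`, uniform
down to `s = 0`. The cap at `1` in `κ` makes `κ s ≤ s`. -/
theorem QuasiCoercive.resolvent_bounds (h : QuasiCoercive J A c e) (hc : 0 < c)
    (hJ : ∀ u, ‖J u‖ ≤ ‖u‖) :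
    ∃ κ : ℝ, 0 < κ ∧ ∀ s : ℝ, 0 ≤ s → ∀ y : H,
      ‖formResolvent J A (e + s : ℝ) y‖ ≤ κ⁻¹ * (1 + s)⁻¹ * ‖y‖ ∧
      ‖Ring.inverse (shiftedForm J A (e + s : ℝ)) (ContinuousLinearMap.adjoint J y)‖ ^ 2 ≤
        κ⁻¹ ^ 2 * (1 + s)⁻¹ * ‖y‖ ^ 2 := by
  refine ⟨min (c / 2) 1, by positivity, fun s hs y => ?_⟩
  set κ := min (c / 2) 1 with hκ
  have hκ0 : 0 < κ := by positivity
  have hκc : κ ≤ c / 2 := min_le_left _ _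
  have hκ1 : κ ≤ 1 := min_le_right _ _
  have h1 := h.re_inner_resolvent_le (z := (e + s : ℝ)) hc (by simpa using hs) y
  set u := Ring.inverse (shiftedForm J A (e + s : ℝ)) (ContinuousLinearMap.adjoint J y) with hu
  have hJu : formResolvent J A (e + s : ℝ) y = J u := rfl
  rw [hJu] at h1 ⊢
  have h2 := hJ u
  rw [Complex.ofReal_re, add_sub_cancel_left] at h1
  have hn := norm_nonneg (J u)
  have hy := norm_nonneg y
  have hs1 : 0 < 1 + s := by linarith
  have h2' : ‖J u‖ ^ 2 ≤ ‖u‖ ^ 2 := by gcongr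
  have h3 : κ * ‖u‖ ^ 2 + κ * (1 + s) * ‖J u‖ ^ 2 ≤ ‖J u‖ * ‖y‖ := by
    refine le_trans ?_ h1
    have a1 : κ * ‖u‖ ^ 2 ≤ c / 2 * ‖u‖ ^ 2 := by gcongr
    have a2 : κ * ‖J u‖ ^ 2 ≤ c / 2 * ‖u‖ ^ 2 := by gcongr
    have a3 : κ * (s * ‖J u‖ ^ 2) ≤ 1 * (s * ‖J u‖ ^ 2) := by gcongr
    linarith
  have h4 : κ * (1 + s) * ‖J u‖ ≤ ‖y‖ := by
    rcases eq_or_lt_of_le hn with h0 | h0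
    · rw [← h0, mul_zero]
      exact hy
    · have : 0 ≤ κ * ‖u‖ ^ 2 := by positivity
      nlinarith
  have h5 : ‖J u‖ ≤ κ⁻¹ * (1 + s)⁻¹ * ‖y‖ := by
    rw [← mul_inv, inv_mul_eq_div, le_div_iff₀ (by positivity)]
    linarith
  refine ⟨h5, ?_⟩
  have h6 : κ * ‖u‖ ^ 2 ≤ κ⁻¹ * (1 + s)⁻¹ * ‖y‖ * ‖y‖ := by
    have : 0 ≤ κ * (1 + s) * ‖J u‖ ^ 2 := by positivity
    have : ‖J u‖ * ‖y‖ ≤ κ⁻¹ * (1 + s)⁻¹ * ‖y‖ * ‖y‖ := by gcongr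
    linarith
  calc ‖u‖ ^ 2 = κ⁻¹ * (κ * ‖u‖ ^ 2) := by field_simp
    _ ≤ κ⁻¹ * (κ⁻¹ * (1 + s)⁻¹ * ‖y‖ * ‖y‖) := by gcongr
    _ = κ⁻¹ ^ 2 * (1 + s)⁻¹ * ‖y‖ ^ 2 := by ring

omit [CompleteSpace G] in
-- For `u = (A + (e+s) J*J)⁻¹ J* y` one has `‖u‖² ≲ (1+s)⁻¹` and `‖J u‖² ≲ (1+s)⁻²`. With `ε ~
-- (1+s)^{-2δ}` the two terms of the form bound decay like `(1+s)^{-1-2δ}` and `(1+s)^{2δβ-2}`. They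
-- balance when `2δ(1+β) = 1`.
theorem HasPolynomialFormBound.resolvent_bound {M β ε₀ : ℝ}
    (hU : HasPolynomialFormBound J U M β ε₀) (hM : 0 < M) (hβ : 0 < β) (hε₀ : 0 < ε₀)
    (h : QuasiCoercive J A c e) (hc : 0 < c) (hJ : ∀ u, ‖J u‖ ≤ ‖u‖) :
    ∃ C δ : ℝ, 0 ≤ C ∧ 0 < δ ∧ ∀ s : ℝ, 0 ≤ s →
      ‖U ∘L Ring.inverse (shiftedForm J A (e + s : ℝ)) ∘L ContinuousLinearMap.adjoint J‖ ≤
        C * (1 + s) ^ (-(1 / 2) - δ : ℝ) := by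
  obtain ⟨κ, hκ, hb⟩ := h.resolvent_bounds hc hJ
  set ε₁ := ε₀ / 2 with hε₁
  have hε₁0 : 0 < ε₁ := by positivity
  set δ := (2 * (1 + β))⁻¹ with hδ
  have hδ0 : 0 < δ := by positivity
  set C := κ⁻¹ * √(ε₁ + M * ε₁ ^ (-β)) with hC
  refine ⟨C, δ, by positivity, hδ0, fun s hs => ?_⟩
  have hs1 : 0 < 1 + s := by linarith
  have hs2 : 1 ≤ 1 + s := by linarith
  refine ContinuousLinearMap.opNorm_le_bound _ (by positivity) fun y => ?_
  obtain ⟨hb1, hb2⟩ := hb s hs y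
  change ‖U (Ring.inverse (shiftedForm J A (e + s : ℝ)) (ContinuousLinearMap.adjoint J y))‖ ≤ _
  have hJu : formResolvent J A (e + s : ℝ) y =
    J (Ring.inverse (shiftedForm J A (e + s : ℝ)) (ContinuousLinearMap.adjoint J y)) := rfl
  rw [hJu] at hb1
  set u := Ring.inverse (shiftedForm J A (e + s : ℝ)) (ContinuousLinearMap.adjoint J y) with hu
  -- The power of `1+s` is at most `1`, so the prefactor `ε₁ = ε₀/2` keeps `ε` below `ε₀` for every
  -- `s ≥ 0`.
  set ε := ε₁ * (1 + s) ^ (-(2 * δ)) with hε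
  have hε0 : 0 < ε := by positivity
  have hεlt : ε < ε₀ := by
    have : (1 + s) ^ (-(2 * δ)) ≤ 1 :=
      Real.rpow_le_one_of_one_le_of_nonpos hs2 (by linarith)
    calc ε ≤ ε₁ * 1 := by rw [hε]; gcongr
      _ < ε₀ := by rw [hε₁]; linarith
  have hU1 := hU ε hε0 hεlt u
  have hexp : 2 * δ * β = 1 - 2 * δ := by
    rw [hδ]
    field_simp
    ring
  have hεβ : ε ^ (-β) = ε₁ ^ (-β) * (1 + s) ^ (1 - 2 * δ) := by
    rw [hε, Real.mul_rpow hε₁0.le (by positivity), ← Real.rpow_mul hs1.le]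
    congr 2
    linarith
  have hp1 : (1 + s) ^ (-(2 * δ)) * (1 + s)⁻¹ = ((1 + s) ^ (-(1 / 2) - δ : ℝ)) ^ 2 := by
    rw [← Real.rpow_neg_one, ← Real.rpow_add hs1, ← Real.rpow_natCast, ← Real.rpow_mul hs1.le]
    congr 1
    push_cast
    ring
  have hp2 : (1 + s) ^ (1 - 2 * δ) * ((1 + s)⁻¹) ^ 2 = ((1 + s) ^ (-(1 / 2) - δ : ℝ)) ^ 2 := by
    rw [← Real.rpow_neg_one, ← Real.rpow_natCast, ← Real.rpow_mul hs1.le, ← Real.rpow_add hs1,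
      ← Real.rpow_natCast, ← Real.rpow_mul hs1.le]
    congr 1
    push_cast
    ring
  have hJ2 : ‖J u‖ ^ 2 ≤ (κ⁻¹ * (1 + s)⁻¹ * ‖y‖) ^ 2 := by gcongr
  have hfin : ‖U u‖ ^ 2 ≤ (C * (1 + s) ^ (-(1 / 2) - δ : ℝ) * ‖y‖) ^ 2 := by
    calc ‖U u‖ ^ 2 ≤ ε * ‖u‖ ^ 2 + M * ε ^ (-β) * ‖J u‖ ^ 2 := hU1
      _ ≤ ε * (κ⁻¹ ^ 2 * (1 + s)⁻¹ * ‖y‖ ^ 2) +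
          M * ε ^ (-β) * (κ⁻¹ * (1 + s)⁻¹ * ‖y‖) ^ 2 := by gcongr
      _ = κ⁻¹ ^ 2 * ‖y‖ ^ 2 * (ε₁ * ((1 + s) ^ (-(2 * δ)) * (1 + s)⁻¹) +
          M * ε₁ ^ (-β) * ((1 + s) ^ (1 - 2 * δ) * ((1 + s)⁻¹) ^ 2)) := by
        rw [hεβ, hε]
        ring
      _ = κ⁻¹ ^ 2 * (ε₁ + M * ε₁ ^ (-β)) * ((1 + s) ^ (-(1 / 2) - δ : ℝ)) ^ 2 * ‖y‖ ^ 2 := by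
        rw [hp1, hp2]
        ring
      _ = (C * (1 + s) ^ (-(1 / 2) - δ : ℝ) * ‖y‖) ^ 2 := by
        rw [hC, mul_pow, mul_pow, mul_pow, Real.sq_sqrt (by positivity)]
  exact (abs_le_of_sq_le_sq' hfin (by positivity)).2

theorem QuasiCoercive.norm_inverse_le (h : QuasiCoercive J A c e) (hc : 0 < c) {z : ℂ}
    (hz : e ≤ z.re) : ‖Ring.inverse (shiftedForm J A z)‖ ≤ c⁻¹ := by
  refine ContinuousLinearMap.opNorm_le_bound _ (by positivity) fun w => ?_
  have h1 := h.le_re_inner_shiftedForm (z := z) (Ring.inverse (shiftedForm J A z) w)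
  rw [shiftedForm_inverse_apply (h.isUnit hc hz)] at h1
  set u := Ring.inverse (shiftedForm J A z) w with hu
  have h2 : 0 ≤ (z.re - e) * ‖J u‖ ^ 2 := mul_nonneg (sub_nonneg.2 hz) (sq_nonneg _)
  have h3 : (⟪u, w⟫_ℂ).re ≤ ‖u‖ * ‖w‖ := (Complex.re_le_norm _).trans (norm_inner_le_norm _ _)
  rw [inv_mul_eq_div, le_div_iff₀ hc]
  rcases eq_or_lt_of_le (norm_nonneg u) with h0 | h0
  · rw [← h0, zero_mul]
    exact norm_nonneg w
  · nlinarith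

theorem QuasiCoercive.continuousOn_inverse (h : QuasiCoercive J A c e) (hc : 0 < c) :
    ContinuousOn (fun s : ℝ => Ring.inverse (shiftedForm J A (e + s : ℝ))) (Ioi 0) := by
  intro s (hs : 0 < s)
  refine ContinuousAt.continuousWithinAt ?_
  have hu : IsUnit (shiftedForm J A (e + s : ℝ)) := h.isUnit hc (by simpa using hs.le)
  obtain ⟨x, hx⟩ := hu
  refine ContinuousAt.comp (f := fun s : ℝ => shiftedForm J A (e + s : ℝ))
    (g := Ring.inverse) ?_ ?_
  · rw [← hx]
    exact NormedRing.inverse_continuousAt x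
  · have : Continuous (fun s : ℝ => shiftedForm J A (e + s : ℝ)) := by
      unfold shiftedForm
      fun_prop
    exact this.continuousAt

theorem QuasiCoercive.integrableOn_formResolvent (h : QuasiCoercive J A c e) (hc : 0 < c)
    (hJ : ∀ u, ‖J u‖ ≤ ‖u‖) :
    IntegrableOn (fun s : ℝ => s ^ (-(1 / 2) : ℝ) • formResolvent J A (e + s : ℝ)) (Ioi 0) := by
  obtain ⟨κ, hκ, hb⟩ := h.resolvent_bounds hc hJ
  refine integrableOn_rpow_smul (c := κ⁻¹) one_pos ?_ fun s hs => ?_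
  · exact continuousOn_const.clm_comp ((h.continuousOn_inverse hc).clm_comp continuousOn_const)
  · exact ContinuousLinearMap.opNorm_le_bound _ (by positivity) fun y => (hb s hs.le y).1

/-- The second resolvent equation. -/
theorem formResolvent_sub {z : ℂ} (hA : A = A₀ + ContinuousLinearMap.adjoint V ∘L U)
    (h₀ : IsUnit (shiftedForm J A₀ z)) (h : IsUnit (shiftedForm J A z)) :
    formResolvent J A z = formResolvent J A₀ z - J ∘L
      ((Ring.inverse (shiftedForm J A₀ z) ∘L ContinuousLinearMap.adjoint V) ∘L
        (U ∘L Ring.inverse (shiftedForm J A z) ∘L ContinuousLinearMap.adjoint J)) := by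
  ext y
  set u := Ring.inverse (shiftedForm J A z) (ContinuousLinearMap.adjoint J y) with hu
  change J u = J (Ring.inverse (shiftedForm J A₀ z) (ContinuousLinearMap.adjoint J y)) -
    J (Ring.inverse (shiftedForm J A₀ z) (ContinuousLinearMap.adjoint V (U u)))
  rw [← map_sub, ← map_sub]
  congr 1
  have h1 : ContinuousLinearMap.adjoint J y = shiftedForm J A z u :=
    (shiftedForm_inverse_apply h _).symm
  have h2 : shiftedForm J A z u = shiftedForm J A₀ z u + ContinuousLinearMap.adjoint V (U u) := by
    rw [shiftedForm, hA, shiftedForm, add_right_comm]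
    rfl
  rw [h1, h2, add_sub_cancel_right, inverse_shiftedForm_apply h₀]

/-- The range of `(T₀ + e)^{-1/2}` remains in the form domain under the perturbation `V* U`. -/
theorem range_sqrtInv_le_of_perturbation {M β ε₀ : ℝ}
    (hU : HasPolynomialFormBound J U M β ε₀) (hM : 0 < M) (hβ : 0 < β) (hε₀ : 0 < ε₀)
    (hA : A = A₀ + ContinuousLinearMap.adjoint V ∘L U) (hc : 0 < c)
    (h₀ : QuasiCoercive J A₀ c e) (h : QuasiCoercive J A c e) (hJ : ∀ u, ‖J u‖ ≤ ‖u‖)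
    (hr : (sqrtInv (fun s : ℝ => formResolvent J A₀ s) e).range ≤ J.range) :
    (sqrtInv (fun s : ℝ => formResolvent J A s) e).range ≤ J.range := by
  obtain ⟨C, δ, hC, hδ, hb⟩ := hU.resolvent_bound hM hβ hε₀ h hc hJ
  -- The correction is integrated as an operator into `K`, so that its integral stays in the form
  -- domain once `J` is applied. The left factor is only bounded in `s`; all the decay comes from
  -- the factor containing `U`.
  set Z : ℝ → H →L[ℂ] K := fun s =>
    (Ring.inverse (shiftedForm J A₀ (e + s : ℝ)) ∘L ContinuousLinearMap.adjoint V) ∘L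
      (U ∘L Ring.inverse (shiftedForm J A (e + s : ℝ)) ∘L ContinuousLinearMap.adjoint J) with hZ
  have hZc : ContinuousOn Z (Ioi 0) :=
    ((h₀.continuousOn_inverse hc).clm_comp continuousOn_const).clm_comp
      (continuousOn_const.clm_comp ((h.continuousOn_inverse hc).clm_comp continuousOn_const))
  have hZb : ∀ s, 0 < s → ‖Z s‖ ≤ c⁻¹ * ‖ContinuousLinearMap.adjoint V‖ *
      (C * (1 + s) ^ (-(1 / 2) - δ : ℝ)) := by
    intro s hs
    refine (ContinuousLinearMap.opNorm_comp_le _ _).trans ?_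
    gcongr
    · refine (ContinuousLinearMap.opNorm_comp_le _ _).trans ?_
      gcongr
      exact h₀.norm_inverse_le hc (by simpa using hs.le)
    · exact hb s hs.le
  have hZi : IntegrableOn (fun s : ℝ => s ^ (-(1 / 2) : ℝ) • Z s) (Ioi 0) := by
    refine Integrable.mono' ((integrableOn_rpow_neg_half_mul_rpow hδ).const_mul
      (c⁻¹ * ‖ContinuousLinearMap.adjoint V‖ * C))
      ((continuousOn_rpow_neg_half.smul hZc).aestronglyMeasurable measurableSet_Ioi) ?_
    filter_upwards [ae_restrict_mem measurableSet_Ioi] with s (hs : 0 < s)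
    rw [norm_smul, Real.norm_of_nonneg (by positivity), mul_left_comm]
    refine (mul_le_mul_of_nonneg_left (hZb s hs) (by positivity)).trans (le_of_eq (by ring))
  have hQ : sqrtInv (fun s : ℝ => formResolvent J A s) e =
      sqrtInv (fun s : ℝ => formResolvent J A₀ s) e -
        J ∘L (Real.pi⁻¹ • ∫ s in Ioi (0 : ℝ), s ^ (-(1 / 2) : ℝ) • Z s) := by
    have hs1 : ∀ s ∈ Ioi (0 : ℝ), s ^ (-(1 / 2) : ℝ) • formResolvent J A (e + s : ℝ) =
        s ^ (-(1 / 2) : ℝ) • formResolvent J A₀ (e + s : ℝ) -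
          ContinuousLinearMap.compL ℂ H K H J (s ^ (-(1 / 2) : ℝ) • Z s) := by
      intro s (hs : 0 < s)
      have hle : e ≤ ((e + s : ℝ) : ℂ).re := by simpa using hs.le
      rw [formResolvent_sub hA (h₀.isUnit hc hle) (h.isUnit hc hle), smul_sub,
        ContinuousLinearMap.compL_apply, ContinuousLinearMap.comp_smul]
    rw [sqrtInv, setIntegral_congr_fun measurableSet_Ioi hs1,
      integral_sub (h₀.integrableOn_formResolvent hc hJ)
        ((ContinuousLinearMap.compL ℂ H K H J).integrable_comp hZi),
      ContinuousLinearMap.integral_comp_comm _ hZi, smul_sub, ContinuousLinearMap.compL_apply,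
      ContinuousLinearMap.comp_smul]
    rfl
  rintro _ ⟨y, rfl⟩
  rw [hQ]
  exact Submodule.sub_mem _ (hr ⟨y, rfl⟩) ⟨_, rfl⟩

end Perturbation

/-! ### Square root domains: stability under perturbation, and symmetric forms. -/

section SquareRootDomains

variable {H K G : Type*} [NormedAddCommGroup H] [InnerProductSpace ℂ H] [CompleteSpace H]
  [NormedAddCommGroup K] [InnerProductSpace ℂ K] [CompleteSpace K]
  [NormedAddCommGroup G] [InnerProductSpace ℂ G] [CompleteSpace G]
variable {J : K →L[ℂ] H} {A A₀ : K →L[ℂ] K} {U V : K →L[ℂ] G} {c r : ℝ} {q q₀ : SesqForm H}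

omit [CompleteSpace H] in
theorem sqrtInv_congr {R R' : ℝ → H →L[ℂ] H} {e e' : ℝ}
    (h : ∀ s, 0 < s → R (e + s) = R' (e' + s)) : sqrtInv R e = sqrtInv R' e' := by
  rw [sqrtInv, sqrtInv, setIntegral_congr_fun measurableSet_Ioi
    fun s hs => congrArg (fun L => s ^ (-(1 / 2) : ℝ) • L) (h s hs)]

theorem adjoint_sqrtInv_formResolvent {e : ℝ} :
    ContinuousLinearMap.adjoint (sqrtInv (fun s : ℝ => formResolvent J A s) e) =
      sqrtInv (fun s : ℝ => formResolvent J (ContinuousLinearMap.adjoint A) s) e := by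
  rw [adjoint_sqrtInv]
  refine sqrtInv_congr fun s _ => ?_
  simp only [adjoint_formResolvent, Complex.conj_ofReal]

/-- Stability of the domains of square roots under a form perturbation `V* U` with polynomial form
bounds. -/
theorem SesqForm.IsRepresentedBy.sqrtOp_domain_of_perturbation
    (hq₀ : q₀.IsRepresentedBy J A₀) (hq : q.IsRepresentedBy J A)
    {M β ε₀ : ℝ} (hM : 0 < M) (hβ : 0 < β) (hε₀ : 0 < ε₀)
    (hU : HasPolynomialFormBound J U M β ε₀) (hV : HasPolynomialFormBound J V M β ε₀)
    (hA : A = A₀ + ContinuousLinearMap.adjoint V ∘L U) (hJ : ∀ u, ‖J u‖ ≤ ‖u‖)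
    (hc : 0 < c) (h₀ : QuasiCoercive J A₀ c r) (h : QuasiCoercive J A c r)
    (hacc : ∀ r : ℝ, 0 < r → ∃ c, 0 < c ∧ QuasiCoercive J A₀ c r)
    (hdom : (sqrtOp q₀.operator).domain = J.range)
    (hdom' : (sqrtOp (q₀.operator†)).domain = J.range)
    {t : ℝ} (ht : IsMAccretive (addScalar q.operator t)) :
    (sqrtOp (addScalar q.operator t)).domain = J.range ∧
      (sqrtOp (addScalar (q.operator†) t)).domain = J.range := by
  -- The given `t` may be smaller than `r`, where coercivity is not available. The shift `e` moves
  -- past `r` and past `0`, so that both operators have form resolvents at all points `t + e + s`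
  -- with `s > 0`.
  obtain ⟨e, he, he', her⟩ : ∃ e : ℝ, 0 < e ∧ 0 < t + e ∧ r ≤ t + e :=
    ⟨|r| + |t| + 1, by positivity, by linarith [abs_nonneg r, neg_abs_le t],
      by linarith [le_abs_self r, neg_abs_le t]⟩
  have hd₀ : Dense (q₀.operator.domain : Set H) := hq₀.dense_domain (h₀.isUnit hc (z := r) (by simp))
  have hd : Dense (q.operator.domain : Set H) := hq.dense_domain (h.isUnit hc (z := r) (by simp))
  have hS := ht.hasResolvent
  have hS' : HasResolvent (addScalar (q.operator†) t)
      (fun s => ContinuousLinearMap.adjoint (inverseShift (addScalar q.operator t) s)) := by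
    refine ⟨fun s hs => ?_, fun s hs => ?_⟩
    · have h1 := (isInverseShift_addScalar.1 (hS.isInverseShift s hs)).adjoint hd
      rw [map_add, Complex.conj_ofReal, Complex.conj_ofReal] at h1
      exact isInverseShift_addScalar.2 h1
    · rw [LinearIsometryEquiv.norm_map]
      exact hS.norm_le s hs
  have hd' : Dense ((addScalar (q.operator†) t).domain : Set H) :=
    (isInverseShift_addScalar.1 (hS.isInverseShift 1 one_pos)).dense_adjoint_domain hd
  set Q₀ := sqrtInv (fun s : ℝ => formResolvent J A₀ s) (t + e) with hQ₀
  set Q := sqrtInv (fun s : ℝ => formResolvent J A s) (t + e) with hQ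
  have hRS : ∀ s : ℝ, 0 < s → r ≤ t + s →
      inverseShift (addScalar q.operator t) s = formResolvent J A (t + s : ℝ) := by
    intro s hs hrs
    refine (isInverseShift_addScalar.2 ?_).inverseShift_eq
    rw [← Complex.ofReal_add]
    exact hq.isInverseShift (h.isUnit hc (by simpa using hrs))
  have hQS : sqrtInv (fun s : ℝ => inverseShift (addScalar q.operator t) s) e = Q := by
    refine sqrtInv_congr fun s hs => ?_
    rw [hRS _ (add_pos he hs) (by linarith), add_assoc]
  have hQQ : Q * Q = formResolvent J A (t + e : ℝ) := by
    rw [← hQS, hS.isResolventFamily.sqrtInv_mul_self he]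
    exact hRS e he her
  have hQQ' : ContinuousLinearMap.adjoint Q * ContinuousLinearMap.adjoint Q =
      formResolvent J (ContinuousLinearMap.adjoint A) (t + e : ℝ) := by
    have h1 := congrArg ContinuousLinearMap.adjoint hQQ
    rw [adjoint_formResolvent, Complex.conj_ofReal] at h1
    rw [← h1]
    exact (ContinuousLinearMap.adjoint_comp Q Q).symm
  have hr₀ : Q₀.range ≤ J.range :=
    ((hq₀.hasResolvent hacc).sqrtOp_domain hd₀ he').symm.trans hdom |>.le
  have hr₀' : (ContinuousLinearMap.adjoint Q₀).range ≤ J.range := by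
    have h1 := ((hq₀.hasResolvent hacc).adjoint hd₀).sqrtOp_domain
      (((hq₀.hasResolvent hacc).isInverseShift 1 one_pos).dense_adjoint_domain hd₀) he'
    rw [← adjoint_sqrtInv, hdom'] at h1
    exact h1.symm.le
  -- Passing to the adjoint exchanges `U` and `V`, which is why both need the form bound.
  have hA' : ContinuousLinearMap.adjoint A =
      ContinuousLinearMap.adjoint A₀ + ContinuousLinearMap.adjoint U ∘L V := by
    rw [hA, map_add, ContinuousLinearMap.adjoint_comp, ContinuousLinearMap.adjoint_adjoint]
  have hr : Q.range ≤ J.range := range_sqrtInv_le_of_perturbation hU hM hβ hε₀ hA hc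
    (h₀.mono her) (h.mono her) hJ hr₀
  have hr' : (ContinuousLinearMap.adjoint Q).range ≤ J.range := by
    rw [hQ₀, adjoint_sqrtInv_formResolvent] at hr₀'
    rw [hQ, adjoint_sqrtInv_formResolvent]
    exact range_sqrtInv_le_of_perturbation hV hM hβ hε₀ hA' hc
      (h₀.mono her).adjoint (h.mono her).adjoint hJ hr₀'
  have hunit : IsUnit (shiftedForm J A (t + e : ℝ)) := h.isUnit hc (by simpa using her)
  have hunit' : IsUnit (shiftedForm J (ContinuousLinearMap.adjoint A) (t + e : ℝ)) :=
    h.adjoint.isUnit hc (by simpa using her)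
  constructor
  · rw [hS.sqrtOp_domain hd he, hQS]
    exact le_antisymm hr (range_le_range_of_adjoint_range_le hq.injective
      (Ring.inverse_mul_cancel _ hunit) hQQ hr')
  · rw [hS'.sqrtOp_domain hd' he, ← adjoint_sqrtInv, hQS]
    refine le_antisymm hr' (range_le_range_of_adjoint_range_le hq.injective
      (Ring.inverse_mul_cancel _ hunit') hQQ' ?_)
    rwa [ContinuousLinearMap.adjoint_adjoint]

/-- For a symmetric form, `J u = Q z` with `Q = (T + e)^{-1/2}` and `‖z‖²` the shifted form at `u`. -/
theorem SesqForm.IsRepresentedBy.exists_sqrtInv_eq (hq : q.IsRepresentedBy J A)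
    (hA : ContinuousLinearMap.adjoint A = A)
    (hacc : ∀ r : ℝ, 0 < r → ∃ c, 0 < c ∧ QuasiCoercive J A c r) {e : ℝ} (he : 0 < e) (u : K) :
    ∃ z : H, sqrtInv (fun s : ℝ => formResolvent J A s) e z = J u ∧
      ‖z‖ ^ 2 = (⟪u, A u⟫_ℂ).re + e * ‖J u‖ ^ 2 := by
  set Q := sqrtInv (fun s : ℝ => formResolvent J A s) e with hQ
  obtain ⟨c, hc, hce⟩ := hacc e he
  have hunit : IsUnit (shiftedForm J A (e : ℝ)) := hce.isUnit hc (by simp)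
  set Y : H →L[ℂ] K :=
    Ring.inverse (shiftedForm J A (e : ℝ)) ∘L ContinuousLinearMap.adjoint J with hY
  have hYd : DenseRange Y := by
    have h1 : Function.Surjective (Ring.inverse (shiftedForm J A (e : ℝ)) : K →L[ℂ] K) := fun w =>
      ⟨_, inverse_shiftedForm_apply hunit w⟩
    exact h1.denseRange.comp (ContinuousLinearMap.denseRange_adjoint hq.injective)
      (ContinuousLinearMap.continuous _)
  have hQa : ContinuousLinearMap.adjoint Q = Q := by
    rw [hQ, adjoint_sqrtInv_formResolvent, hA]
  have hQQ : ∀ w, Q (Q w) = J (Y w) := (hq.hasResolvent hacc).sqrtInv_sqrtInv he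
  have hnorm : ∀ w, ‖Q w‖ ^ 2 = (⟪Y w, A (Y w)⟫_ℂ).re + e * ‖J (Y w)‖ ^ 2 := by
    intro w
    have h1 : shiftedForm J A (e : ℝ) (Y w) = ContinuousLinearMap.adjoint J w :=
      shiftedForm_inverse_apply hunit _
    have h2 := re_inner_shiftedForm (J := J) (A := A) (z := (e : ℝ)) (Y w)
    rw [h1, ContinuousLinearMap.adjoint_inner_right, ← hQQ, Complex.ofReal_re,
      ← ContinuousLinearMap.adjoint_inner_right, hQa] at h2
    rw [← hQQ, ← h2]
    exact (inner_self_eq_norm_sq (𝕜 := ℂ) (Q w)).symm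
  have hbound : ∃ C, ∀ w, ‖Q w‖ ≤ C * ‖Y w‖ := by
    refine ⟨√(‖A‖ + e * ‖J‖ ^ 2), fun w => ?_⟩
    have h1 : (⟪Y w, A (Y w)⟫_ℂ).re ≤ ‖A‖ * ‖Y w‖ ^ 2 := by
      refine (Complex.re_le_norm _).trans ((norm_inner_le_norm _ _).trans ?_)
      nlinarith [A.le_opNorm (Y w), norm_nonneg (Y w)]
    have h2 : ‖J (Y w)‖ ^ 2 ≤ (‖J‖ * ‖Y w‖) ^ 2 := by
      gcongr
      exact J.le_opNorm _
    refine (abs_le_of_sq_le_sq' ?_ (by positivity)).2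
    rw [hnorm, mul_pow, Real.sq_sqrt (by positivity)]
    nlinarith
  -- `E` is `Q⁻¹ J`, defined on the dense range of `Y` by `Y w ↦ Q w` and extended by continuity.
  -- Since `Q` is self-adjoint, `‖Q w‖² = ⟪Q² w, w⟫` is the shifted form at `Y w`, which gives the
  -- bound and, in the limit, the norm identity.
  set E := (Q : H →ₗ[ℂ] H).extendOfNorm (Y : H →ₗ[ℂ] K) with hE
  have hEY : ∀ w, E (Y w) = Q w := LinearMap.extendOfNorm_eq hYd hbound
  refine ⟨E u, ?_, ?_⟩
  · refine congrFun (hYd.equalizer (g := fun u => Q (E u)) (h := fun u => J u)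
      (by fun_prop) (by fun_prop) ?_) u
    funext w
    change Q (E (Y w)) = J (Y w)
    rw [hEY, hQQ]
  · refine congrFun (hYd.equalizer (g := fun u => ‖E u‖ ^ 2)
      (h := fun u => (⟪u, A u⟫_ℂ).re + e * ‖J u‖ ^ 2) (by fun_prop) ?_ ?_) u
    · refine (Complex.continuous_re.comp (continuous_id.inner A.continuous)).add (by fun_prop)
    · funext w
      change ‖E (Y w)‖ ^ 2 = _
      rw [hEY, hnorm]
      rfl

/-- The square root of the operator of a symmetric form is bounded on the form domain by the
form. -/
theorem SesqForm.IsRepresentedBy.norm_sqrtOp_sq_le (hq : q.IsRepresentedBy J A)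
    (hA : ContinuousLinearMap.adjoint A = A)
    (hacc : ∀ r : ℝ, 0 < r → ∃ c, 0 < c ∧ QuasiCoercive J A c r) (u : K) :
    ∃ hu : J u ∈ (sqrtOp q.operator).domain,
      ‖sqrtOp q.operator ⟨J u, hu⟩‖ ^ 2 ≤ (⟪u, A u⟫_ℂ).re := by
  have hR := hq.hasResolvent hacc
  have hd : Dense (q.operator.domain : Set H) := by
    obtain ⟨c, hc, h1⟩ := hacc 1 one_pos
    exact hq.dense_domain (h1.isUnit hc (z := (1 : ℝ)) (by simp))
  have hu : J u ∈ (sqrtOp q.operator).domain := by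
    rw [hR.sqrtOp_domain hd one_pos]
    obtain ⟨z, hz, -⟩ := hq.exists_sqrtInv_eq hA hacc one_pos u
    exact ⟨z, hz⟩
  refine ⟨hu, ?_⟩
  -- Here the square root is `z + Δ_e J u`, with `‖z‖²` the form shifted by `e` and `‖Δ_e‖ ≤ √e`.
  -- Letting `e → 0` removes both corrections.
  have hb : ∀ e : ℝ, 0 < e → ‖sqrtOp q.operator ⟨J u, hu⟩‖ ≤
      √((⟪u, A u⟫_ℂ).re + e * ‖J u‖ ^ 2) + √e * ‖J u‖ := by
    intro e he
    obtain ⟨z, hz, hz2⟩ := hq.exists_sqrtInv_eq hA hacc he u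
    have h1 := hR.sqrtInv_sqrtOp_sub hd he ⟨J u, hu⟩
    have h2 := hR.sqrtInv_injective he (h1.trans hz.symm)
    rw [sub_eq_iff_eq_add] at h2
    rw [h2, ← hz2, Real.sqrt_sq (norm_nonneg z)]
    refine (norm_add_le _ _).trans ?_
    gcongr
    exact ContinuousLinearMap.le_of_opNorm_le _ (hR.norm_sqrtShiftDiff_le he) _
  have hl : Filter.Tendsto
      (fun e : ℝ => √((⟪u, A u⟫_ℂ).re + e * ‖J u‖ ^ 2) + √e * ‖J u‖) (𝓝[>] 0)
      (𝓝 √((⟪u, A u⟫_ℂ).re)) := by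
    have h1 : Continuous
        (fun e : ℝ => √((⟪u, A u⟫_ℂ).re + e * ‖J u‖ ^ 2) + √e * ‖J u‖) := by fun_prop
    have h2 := h1.tendsto 0
    simp only [zero_mul, add_zero, Real.sqrt_zero] at h2
    exact h2.mono_left nhdsWithin_le_nhds
  have h3 : ‖sqrtOp q.operator ⟨J u, hu⟩‖ ≤ √((⟪u, A u⟫_ℂ).re) := by
    refine ge_of_tendsto hl ?_
    filter_upwards [self_mem_nhdsWithin] with e he using hb e he
  have h4 : 0 ≤ (⟪u, A u⟫_ℂ).re := by
    have h5 : ∀ e : ℝ, 0 < e → 0 ≤ (⟪u, A u⟫_ℂ).re + e * ‖J u‖ ^ 2 := by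
      intro e he
      obtain ⟨c, hc, h6⟩ := hacc e he
      exact le_trans (by positivity) (h6 u)
    have h7 : Filter.Tendsto (fun e : ℝ => (⟪u, A u⟫_ℂ).re + e * ‖J u‖ ^ 2) (𝓝[>] 0)
        (𝓝 (⟪u, A u⟫_ℂ).re) := by
      have h8 : Continuous (fun e : ℝ => (⟪u, A u⟫_ℂ).re + e * ‖J u‖ ^ 2) := by fun_prop
      have h9 := h8.tendsto 0
      simp only [zero_mul, add_zero] at h9
      exact h9.mono_left nhdsWithin_le_nhds
    refine ge_of_tendsto h7 ?_
    filter_upwards [self_mem_nhdsWithin] with e he using h5 e he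
  calc ‖sqrtOp q.operator ⟨J u, hu⟩‖ ^ 2 ≤ √((⟪u, A u⟫_ℂ).re) ^ 2 := by gcongr
    _ = _ := Real.sq_sqrt h4

end SquareRootDomains

theorem inner_adjoint_comp_comp {K G : Type*} [NormedAddCommGroup K] [InnerProductSpace ℂ K]
    [CompleteSpace K] [NormedAddCommGroup G] [InnerProductSpace ℂ G] [CompleteSpace G]
    (D : K →L[ℂ] G) (B : G →L[ℂ] G) (w u : K) :
    ⟪w, (ContinuousLinearMap.adjoint D ∘L B ∘L D) u⟫_ℂ = ⟪D w, B (D u)⟫_ℂ :=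
  ContinuousLinearMap.adjoint_inner_right D w (B (D u))

/-! ### The elliptic form on `L²(Ω)ⁿ` as a bounded operator. -/

section MatrixForm

variable {n : ℕ} {Ω : Set (EuclideanSpace ℝ (Fin n))}
  {a : EuclideanSpace ℝ (Fin n) → Matrix (Fin n) (Fin n) ℂ} {a₁ a₂ : ℝ}

theorem integral_norm_mul_norm_le (F G : L2vec Ω) :
    ∫ x in Ω, ‖F x‖ * ‖G x‖ ≤ ‖F‖ * ‖G‖ := by
  have hF := (Lp.memLp F).norm
  have hG := (Lp.memLp G).norm
  have hnorm : ∀ F : L2vec Ω, ‖(Lp.memLp F).norm.toLp (fun x => ‖F x‖)‖ = ‖F‖ := by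
    intro F
    rw [Lp.norm_toLp, eLpNorm_norm, Lp.norm_def]
  have h1 : ∫ x in Ω, ‖F x‖ * ‖G x‖ = ⟪hG.toLp, hF.toLp⟫_ℝ := by
    rw [L2.inner_def]
    refine integral_congr_ae ?_
    filter_upwards [hF.coeFn_toLp, hG.coeFn_toLp] with x h1 h2
    rw [h1, h2]
    simp
  rw [h1, ← hnorm F, ← hnorm G, mul_comm]
  exact real_inner_le_norm _ _

theorem norm_matrixForm_le (ha : IsUniformlyElliptic Ω a a₁ a₂) (F G : L2vec Ω) :
    ‖matrixForm ha F G‖ ≤ a₂ * ‖F‖ * ‖G‖ := by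
  have hint : Integrable (fun x => a₂ * (‖F x‖ * ‖G x‖)) (volume.restrict Ω) :=
    ((Lp.memLp F).norm.integrable_mul (Lp.memLp G).norm).const_mul a₂
  have h1 : ‖matrixForm ha F G‖ ≤ ∫ x in Ω, a₂ * (‖F x‖ * ‖G x‖) := by
    refine norm_integral_le_of_norm_le hint ?_
    filter_upwards [ha.bounded] with x hx
    rw [mul_comm ‖F x‖, ← mul_assoc]
    exact hx _ _
  rw [integral_const_mul] at h1
  refine h1.trans ?_
  rw [mul_assoc]
  exact mul_le_mul_of_nonneg_left (integral_norm_mul_norm_le F G) (ha.pos.le.trans ha.le)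

theorem le_re_matrixForm (ha : IsUniformlyElliptic Ω a a₁ a₂) (F : L2vec Ω) :
    a₁ * ‖F‖ ^ 2 ≤ (matrixForm ha F F).re := by
  have h1 : ‖F‖ ^ 2 = ∫ x in Ω, ‖F x‖ ^ 2 := by
    rw [← inner_self_eq_norm_sq (𝕜 := ℂ), L2.inner_def, ← integral_re (L2.integrable_inner F F)]
    simp only [inner_self_eq_norm_sq]
  have h2 : (matrixForm ha F F).re =
      ∫ x in Ω, (⟪F x, Matrix.toEuclideanLin (a x) (F x)⟫_ℂ).re :=
    (integral_re (ha.integrable F F)).symm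
  rw [h1, h2, ← integral_const_mul]
  refine integral_mono_ae ?_ (ha.integrable F F).re ?_
  · have := (Lp.memLp F).norm.integrable_sq
    exact this.const_mul a₁
  · filter_upwards [ha.elliptic] with x hx using hx _

theorem matrixForm_one (F G : L2vec Ω) :
    matrixForm (isUniformlyElliptic_one Ω) F G = ⟪F, G⟫_ℂ := by
  rw [L2.inner_def]
  change ∫ x in Ω, ⟪F x, Matrix.toEuclideanLin 1 (G x)⟫_ℂ = _
  simp [Matrix.toLpLin_one]

/-- The bounded operator on `L²(Ω)ⁿ` of multiplication by `a`, obtained from its form. -/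
theorem exists_matrixForm_eq_inner (ha : IsUniformlyElliptic Ω a a₁ a₂) :
    ∃ B : L2vec Ω →L[ℂ] L2vec Ω, ∀ F G, matrixForm ha F G = ⟪F, B G⟫_ℂ := by
  refine ⟨ContinuousLinearMap.adjoint (InnerProductSpace.continuousLinearMapOfBilin
    ((matrixForm ha).mkContinuous₂ a₂ (norm_matrixForm_le ha))), fun F G => ?_⟩
  rw [ContinuousLinearMap.adjoint_inner_right,
    InnerProductSpace.continuousLinearMapOfBilin_apply, LinearMap.mkContinuous₂_apply]

end MatrixForm

/-! ### Uniqueness of weak gradients and density of 𝒲. -/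

section TestFunctions

variable {n : ℕ} {Ω : Set (EuclideanSpace ℝ (Fin n))}

theorem IsTestFunction.ofReal {g : EuclideanSpace ℝ (Fin n) → ℝ} (hg : ContDiff ℝ ∞ g)
    (hc : HasCompactSupport g) (hs : tsupport g ⊆ Ω) :
    IsTestFunction Ω (fun x => (g x : ℂ)) := by
  refine ⟨Complex.ofRealCLM.contDiff.comp hg, hc.comp_left Complex.ofReal_zero, ?_⟩
  refine (closure_mono ?_).trans hs
  intro x hx hx0
  exact hx (by simp [hx0])

theorem ae_eq_zero_of_integral_testFunction (hΩ : IsOpen Ω)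
    {f : EuclideanSpace ℝ (Fin n) → ℂ} (hf : MemLp f 2 (volume.restrict Ω))
    (h : ∀ g : EuclideanSpace ℝ (Fin n) → ℝ, IsTestFunction Ω (fun x => (g x : ℂ)) →
      ∫ x in Ω, (g x : ℂ) * f x = 0) : f =ᵐ[volume.restrict Ω] 0 := by
  have hloc : LocallyIntegrableOn f Ω volume :=
    locallyIntegrableOn_of_locallyIntegrable_restrict (hf.locallyIntegrable (by norm_num))
  have h1 := hΩ.ae_eq_zero_of_integral_contDiff_smul_eq_zero hloc fun g hg hc hs => by
    rw [← h g (IsTestFunction.ofReal hg hc hs)]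
    symm
    refine (setIntegral_eq_integral_of_forall_compl_eq_zero fun x hx => ?_).trans ?_
    · have : g x = 0 := image_eq_zero_of_notMem_tsupport fun h' => hx (hs h')
      simp [this]
    · simp only [Complex.real_smul]
  rwa [Filter.EventuallyEq, ae_restrict_iff' hΩ.measurableSet]

theorem eq_zero_of_zero_mem_sobolevGraph (hΩ : IsOpen Ω) {p : L2 Ω × L2vec Ω}
    (hp : p ∈ sobolevGraph Ω) (hp0 : p.1 = 0) : p.2 = 0 := by
  have h1 : ∀ j, (fun x => p.2 x j) =ᵐ[volume.restrict Ω] 0 := by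
    intro j
    refine ae_eq_zero_of_integral_testFunction hΩ (memLp_coord p.2 j) fun g hg => ?_
    have h2 := hp _ hg j
    have h3 : ∫ x in Ω, p.1 x * partialDeriv j (fun x => (g x : ℂ)) x = 0 := by
      refine integral_eq_zero_of_ae ?_
      rw [hp0]
      filter_upwards [Lp.coeFn_zero ℂ 2 (volume.restrict Ω)] with x hx
      rw [hx, Pi.zero_apply, zero_mul]
    rw [h3, zero_eq_neg] at h2
    rw [← h2]
    simp only [mul_comm]
  rw [Lp.eq_zero_iff_ae_eq_zero]
  filter_upwards [ae_all_iff.2 h1] with x hx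
  ext j
  exact hx j

theorem IsFormSpace.dense {𝒲 : Submodule ℂ (L2 Ω)} (h𝒲 : IsFormSpace Ω 𝒲) (hΩ : IsOpen Ω) :
    Dense (𝒲 : Set (L2 Ω)) := by
  rw [Submodule.dense_iff_topologicalClosure_eq_top, Submodule.topologicalClosure_eq_top_iff,
    Submodule.eq_bot_iff]
  intro f hf
  rw [Lp.eq_zero_iff_ae_eq_zero]
  refine ae_eq_zero_of_integral_testFunction hΩ (Lp.memLp f) fun g hg => ?_
  have h1 := hf _ (h𝒲.test_mem (hg.memLp.toLp _) _ hg hg.memLp.coeFn_toLp)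
  rw [L2.inner_def] at h1
  rw [← h1]
  refine integral_congr_ae ?_
  filter_upwards [hg.memLp.coeFn_toLp] with x hx
  rw [hx]
  simp [mul_comm]

end TestFunctions

/-! ### The form domain as a Hilbert space. -/

section FormSpace

variable {n : ℕ} {Ω : Set (EuclideanSpace ℝ (Fin n))} {𝒲 : Submodule ℂ (L2 Ω)}

/-- The partial map made from `sobolevGraph` takes the expected value only because the graph is
single-valued, which is the uniqueness of weak gradients on an open set. -/
theorem weakGrad_eq (hΩ : IsOpen Ω) {p : L2 Ω × L2vec Ω} (hp : p ∈ sobolevGraph Ω)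
    (hd : p.1 ∈ sobolev Ω) : weakGrad Ω ⟨p.1, hd⟩ = p.2 := by
  have h1 : (p.1, weakGrad Ω ⟨p.1, hd⟩) ∈ sobolevGraph Ω :=
    Submodule.mem_graph_toLinearPMap
      (fun q hq hq0 => eq_zero_of_zero_mem_sobolevGraph hΩ hq hq0) ⟨p.1, hd⟩
  have h2 := eq_zero_of_zero_mem_sobolevGraph hΩ (Submodule.sub_mem _ h1 hp) (sub_self _)
  exact sub_eq_zero.1 h2

/-- `K` is the form domain `𝒲` with the norm of `W^{1,2}(Ω)`, embedded in `L²(Ω)` by `J` and with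
the gradient `D`. -/
structure IsSobolevEmbedding {K : Type*} [NormedAddCommGroup K] [InnerProductSpace ℂ K]
    (𝒲 : Submodule ℂ (L2 Ω)) (J : K →L[ℂ] L2 Ω) (D : K →L[ℂ] L2vec Ω) : Prop where
  norm_sq : ∀ u, ‖u‖ ^ 2 = ‖J u‖ ^ 2 + ‖D u‖ ^ 2
  mem_graph : ∀ u, (J u, D u) ∈ sobolevGraph Ω
  range_eq : J.range = 𝒲

/-- The form domain `𝒲` as the space of pairs `(f, ∇f)`. -/
noncomputable def gradGraph (𝒲 : Submodule ℂ (L2 Ω)) : Submodule ℂ (WithLp 2 (L2 Ω × L2vec Ω)) :=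
  (sobolevGraph Ω ⊓ 𝒲.comap (LinearMap.fst ℂ (L2 Ω) (L2vec Ω))).comap
    (WithLp.linearEquiv 2 ℂ (L2 Ω × L2vec Ω)).toLinearMap

theorem IsFormSpace.isClosed_gradGraph (h𝒲 : IsFormSpace Ω 𝒲) :
    IsClosed (gradGraph 𝒲 : Set (WithLp 2 (L2 Ω × L2vec Ω))) :=
  h𝒲.isClosed.preimage (WithLp.prodContinuousLinearEquiv 2 ℂ (L2 Ω) (L2vec Ω)).continuous

theorem IsFormSpace.isSobolevEmbedding (h𝒲 : IsFormSpace Ω 𝒲) :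
    IsSobolevEmbedding 𝒲 (WithLp.fstL 2 ℂ (L2 Ω) (L2vec Ω) ∘L (gradGraph 𝒲).subtypeL)
      (WithLp.sndL 2 ℂ (L2 Ω) (L2vec Ω) ∘L (gradGraph 𝒲).subtypeL) where
  norm_sq u := WithLp.prod_norm_sq_eq_of_L2 (u : WithLp 2 (L2 Ω × L2vec Ω))
  mem_graph u := u.2.1
  range_eq := by
    ext f
    constructor
    · rintro ⟨u, rfl⟩
      exact u.2.2
    · intro hf
      obtain ⟨p, hp, hpf⟩ := Submodule.mem_map.1 (h𝒲.le_sobolev hf)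
      have hpf' : p.1 = f := hpf
      subst hpf'
      exact ⟨⟨WithLp.toLp 2 p, hp, hf⟩, rfl⟩

namespace IsSobolevEmbedding

variable {K : Type*} [NormedAddCommGroup K] [InnerProductSpace ℂ K]
  {J : K →L[ℂ] L2 Ω} {D : K →L[ℂ] L2vec Ω} (hK : IsSobolevEmbedding 𝒲 J D)
include hK

theorem norm_le (u : K) : ‖J u‖ ≤ ‖u‖ := by
  refine (abs_le_of_sq_le_sq' ?_ (norm_nonneg u)).2
  rw [hK.norm_sq]
  linarith [sq_nonneg ‖D u‖]

theorem norm_grad_le (u : K) : ‖D u‖ ≤ ‖u‖ := by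
  refine (abs_le_of_sq_le_sq' ?_ (norm_nonneg u)).2
  rw [hK.norm_sq]
  linarith [sq_nonneg ‖J u‖]

theorem mem (u : K) : J u ∈ 𝒲 := hK.range_eq ▸ ⟨u, rfl⟩

theorem gradOn_eq (hΩ : IsOpen Ω) (h𝒲 : IsFormSpace Ω 𝒲) (u : K) (hu : J u ∈ 𝒲) :
    gradOn h𝒲 ⟨J u, hu⟩ = D u :=
  weakGrad_eq hΩ (hK.mem_graph u) (h𝒲.le_sobolev hu)

theorem injective (hΩ : IsOpen Ω) : Function.Injective J := by
  refine (injective_iff_map_eq_zero J).2 fun u hu => ?_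
  have h1 : D u = 0 := eq_zero_of_zero_mem_sobolevGraph hΩ (hK.mem_graph u) hu
  have h2 := hK.norm_sq u
  rw [hu, h1] at h2
  simpa using h2

theorem denseRange (hΩ : IsOpen Ω) (h𝒲 : IsFormSpace Ω 𝒲) : DenseRange J := by
  have h1 := h𝒲.dense hΩ
  rwa [← hK.range_eq] at h1

variable {a : EuclideanSpace ℝ (Fin n) → Matrix (Fin n) (Fin n) ℂ} {a₁ a₂ : ℝ}

theorem ellipticForm_apply (hΩ : IsOpen Ω) (h𝒲 : IsFormSpace Ω 𝒲)
    (ha : IsUniformlyElliptic Ω a a₁ a₂) (w u : K) (hw : J w ∈ 𝒲) (hu : J u ∈ 𝒲) :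
    (ellipticForm h𝒲 ha).form ⟨J w, hw⟩ ⟨J u, hu⟩ = matrixForm ha (D w) (D u) := by
  rw [← hK.gradOn_eq hΩ h𝒲 w hw, ← hK.gradOn_eq hΩ h𝒲 u hu]
  rfl

variable [CompleteSpace K] {B : L2vec Ω →L[ℂ] L2vec Ω}

theorem ellipticForm_isRepresentedBy (hΩ : IsOpen Ω) (h𝒲 : IsFormSpace Ω 𝒲)
    (ha : IsUniformlyElliptic Ω a a₁ a₂) (hB : ∀ F G, matrixForm ha F G = ⟪F, B G⟫_ℂ) :
    (ellipticForm h𝒲 ha).IsRepresentedBy J (ContinuousLinearMap.adjoint D ∘L B ∘L D) where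
  injective := hK.injective hΩ
  denseRange := hK.denseRange hΩ h𝒲
  range_eq := hK.range_eq
  form_eq w u hw hu := by
    rw [inner_adjoint_comp_comp, ← hB]
    exact hK.ellipticForm_apply hΩ h𝒲 ha w u hw hu

theorem quasiCoercive (ha : IsUniformlyElliptic Ω a a₁ a₂)
    (hB : ∀ F G, matrixForm ha F G = ⟪F, B G⟫_ℂ) {r : ℝ} (hr : 0 < r) :
    ∃ c, 0 < c ∧ QuasiCoercive J (ContinuousLinearMap.adjoint D ∘L B ∘L D) c r := by
  refine ⟨min a₁ r, lt_min ha.pos hr, fun u => ?_⟩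
  have h1 := le_re_matrixForm ha (D u)
  rw [inner_adjoint_comp_comp, ← hB, hK.norm_sq, mul_add]
  have h2 : min a₁ r * ‖J u‖ ^ 2 ≤ r * ‖J u‖ ^ 2 := by
    gcongr
    exact min_le_right _ _
  have h3 : min a₁ r * ‖D u‖ ^ 2 ≤ a₁ * ‖D u‖ ^ 2 := by
    gcongr
    exact min_le_left _ _
  linarith

/-- On `𝒲`, the square root of `-Δ_𝒲` is defined and bounded by the gradient. -/
theorem norm_sqrtOp_negLaplacian_sq_le (hΩ : IsOpen Ω) (h𝒲 : IsFormSpace Ω 𝒲) (u : K) :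
    ∃ hu : J u ∈ (sqrtOp (negLaplacian h𝒲)).domain,
      ‖sqrtOp (negLaplacian h𝒲) ⟨J u, hu⟩‖ ^ 2 ≤ ‖D u‖ ^ 2 := by
  have hB : ∀ F G : L2vec Ω, matrixForm (isUniformlyElliptic_one Ω) F G =
      ⟪F, ContinuousLinearMap.id ℂ (L2vec Ω) G⟫_ℂ := matrixForm_one
  have hsymm : ContinuousLinearMap.adjoint
      (ContinuousLinearMap.adjoint D ∘L ContinuousLinearMap.id ℂ (L2vec Ω) ∘L D) =
      ContinuousLinearMap.adjoint D ∘L ContinuousLinearMap.id ℂ (L2vec Ω) ∘L D := by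
    rw [ContinuousLinearMap.id_comp, ContinuousLinearMap.adjoint_comp,
      ContinuousLinearMap.adjoint_adjoint]
  obtain ⟨hu, h1⟩ := (hK.ellipticForm_isRepresentedBy hΩ h𝒲 (isUniformlyElliptic_one Ω)
    hB).norm_sqrtOp_sq_le hsymm (fun r hr => hK.quasiCoercive (isUniformlyElliptic_one Ω) hB hr) u
  refine ⟨hu, h1.trans (le_of_eq ?_)⟩
  rw [inner_adjoint_comp_comp]
  exact inner_self_eq_norm_sq (𝕜 := ℂ) _

end IsSobolevEmbedding

end FormSpace

/-! ### The two factors of the potential. -/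

section Potential

variable {n : ℕ} {Ω : Set (EuclideanSpace ℝ (Fin n))} {V : EuclideanSpace ℝ (Fin n) → ℂ}

theorem norm_uPart (V : EuclideanSpace ℝ (Fin n) → ℂ) (x : EuclideanSpace ℝ (Fin n)) :
    ‖uPart V x‖ = ‖vPart V x‖ := by
  rw [uPart, norm_mul, mul_comm Complex.I, Complex.norm_exp_ofReal_mul_I, one_mul]

theorem norm_mulOp_uPart {f : L2 Ω} (hu : f ∈ (mulOp Ω (uPart V)).domain)
    (hv : f ∈ (mulOp Ω (vPart V)).domain) :
    ‖mulOp Ω (uPart V) ⟨f, hu⟩‖ = ‖mulOp Ω (vPart V) ⟨f, hv⟩‖ := by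
  change ‖(mem_mulDomain.1 hu).toLp (fun x => uPart V x * f x)‖ =
    ‖(mem_mulDomain.1 hv).toLp (fun x => vPart V x * f x)‖
  rw [Lp.norm_toLp, Lp.norm_toLp]
  congr 1
  refine eLpNorm_congr_norm_ae (Filter.Eventually.of_forall fun x => ?_)
  rw [norm_mul, norm_mul, norm_uPart]

end Potential

theorem inner_add_adjoint_comp {K G : Type*} [NormedAddCommGroup K] [InnerProductSpace ℂ K]
    [CompleteSpace K] [NormedAddCommGroup G] [InnerProductSpace ℂ G] [CompleteSpace G]
    (A : K →L[ℂ] K) (T U : K →L[ℂ] G) (w u : K) :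
    ⟪w, (A + ContinuousLinearMap.adjoint T ∘L U) u⟫_ℂ = ⟪w, A u⟫_ℂ + ⟪T w, U u⟫_ℂ := by
  rw [← ContinuousLinearMap.adjoint_inner_right T w (U u), ← inner_add_right]
  rfl

/-! ### Relative bounds for the potential, and the form sum. -/

section FormSum

variable {n : ℕ} {Ω : Set (EuclideanSpace ℝ (Fin n))} {𝒲 : Submodule ℂ (L2 Ω)}
  {V : EuclideanSpace ℝ (Fin n) → ℂ}

theorem norm_potentialForm_le (hV : AEMeasurable V (volume.restrict Ω))
    (f : (mulOp Ω (vPart V)).domain) :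
    ‖(potentialForm hV).form f f‖ ≤ ‖mulOp Ω (vPart V) f‖ ^ 2 := by
  have h1 : ‖(potentialForm hV).form f f‖ ≤ ‖mulOp Ω (vPart V) f‖ *
      ‖mulOp Ω (uPart V) (Submodule.inclusion (vPart_domain_le hV) f)‖ :=
    norm_inner_le_norm (𝕜 := ℂ) (mulOp Ω (vPart V) f)
      (mulOp Ω (uPart V) (Submodule.inclusion (vPart_domain_le hV) f))
  rw [show ‖mulOp Ω (uPart V) (Submodule.inclusion (vPart_domain_le hV) f)‖ =
    ‖mulOp Ω (vPart V) f‖ from norm_mulOp_uPart (vPart_domain_le hV f.2) f.2, ← sq] at h1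
  exact h1

variable {K : Type*} [NormedAddCommGroup K] [InnerProductSpace ℂ K]
  {J : K →L[ℂ] L2 Ω} {D : K →L[ℂ] L2vec Ω}

/-- A multiplication operator defined and bounded on `𝒲`, as a bounded operator on the form
domain. -/
theorem exists_clm_eq_mulOp {m : EuclideanSpace ℝ (Fin n) → ℂ}
    (hJ : ∀ u, J u ∈ (mulOp Ω m).domain) {C : ℝ}
    (hC : ∀ u, ‖mulOp Ω m ⟨J u, hJ u⟩‖ ≤ C * ‖u‖) :
    ∃ T : K →L[ℂ] L2 Ω, ∀ u, T u = mulOp Ω m ⟨J u, hJ u⟩ :=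
  ⟨((mulOp Ω m).toFun ∘ₗ (J : K →ₗ[ℂ] L2 Ω).codRestrict _ hJ).mkContinuous C hC, fun _ => rfl⟩

namespace IsSobolevEmbedding

variable (hK : IsSobolevEmbedding 𝒲 J D)
include hK

variable {a : EuclideanSpace ℝ (Fin n) → Matrix (Fin n) (Fin n) ℂ} {a₁ a₂ : ℝ} {M β ε₀ : ℝ}

/-- Each `J u` lies in the domain of `(-Δ)^{1/2}`, so the hypothesis applies to all of 𝒲; there the
square root is dominated by the gradient. -/
theorem polynomialFormBound [CompleteSpace K] (hΩ : IsOpen Ω) (h𝒲 : IsFormSpace Ω 𝒲)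
    (hdom : 𝒲 ≤ (mulOp Ω (vPart V)).domain)
    (hbound : ∀ ε : ℝ, 0 < ε → ε < ε₀ →
      ∀ (f : L2 Ω) (hf : f ∈ 𝒲) (hfΔ : f ∈ (sqrtOp (negLaplacian h𝒲)).domain),
        ‖mulOp Ω (vPart V) ⟨f, hdom hf⟩‖ ^ 2 ≤
          ε * ‖sqrtOp (negLaplacian h𝒲) ⟨f, hfΔ⟩‖ ^ 2 + M * ε ^ (-β) * ‖f‖ ^ 2)
    {ε : ℝ} (hε : 0 < ε) (hεε₀ : ε < ε₀) (u : K) :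
    ‖mulOp Ω (vPart V) ⟨J u, hdom (hK.mem u)⟩‖ ^ 2 ≤
      ε * ‖D u‖ ^ 2 + M * ε ^ (-β) * ‖J u‖ ^ 2 := by
  obtain ⟨hu, h1⟩ := hK.norm_sqrtOp_negLaplacian_sq_le hΩ h𝒲 u
  refine (hbound ε hε hεε₀ (J u) (hK.mem u) hu).trans ?_
  gcongr

/-- The gradient bound is used with `a₁ ε` in place of `ε`. Ellipticity absorbs `a₁` into the real
part of the form, and `(a₁ ε)^{-β}` yields the factor `a₁^{-β}`. -/
theorem potential_le_ellipticForm (hΩ : IsOpen Ω) (h𝒲 : IsFormSpace Ω 𝒲)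
    (ha : IsUniformlyElliptic Ω a a₁ a₂) (hdom : 𝒲 ≤ (mulOp Ω (vPart V)).domain)
    (hb : ∀ ε : ℝ, 0 < ε → ε < ε₀ → ∀ u : K,
      ‖mulOp Ω (vPart V) ⟨J u, hdom (hK.mem u)⟩‖ ^ 2 ≤
        ε * ‖D u‖ ^ 2 + M * ε ^ (-β) * ‖J u‖ ^ 2)
    {ε : ℝ} (hε : 0 < ε) (hεε₀ : ε < a₁⁻¹ * ε₀) (f : L2 Ω) (hf : f ∈ 𝒲) :
    ‖mulOp Ω (vPart V) ⟨f, hdom hf⟩‖ ^ 2 ≤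
      ε * ((ellipticForm h𝒲 ha).form ⟨f, hf⟩ ⟨f, hf⟩).re +
        M * a₁ ^ (-β) * ε ^ (-β) * ‖f‖ ^ 2 := by
  obtain ⟨u, rfl⟩ : f ∈ J.range := by rwa [hK.range_eq]
  have h1 := hb (a₁ * ε) (mul_pos ha.pos hε) (by
    rw [inv_mul_eq_div, lt_div_iff₀ ha.pos] at hεε₀
    linarith) u
  have h2 := le_re_matrixForm ha (D u)
  have h3 : ((ellipticForm h𝒲 ha).form ⟨J u, hf⟩ ⟨J u, hf⟩).re = (matrixForm ha (D u) (D u)).re :=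
    congrArg Complex.re (hK.ellipticForm_apply hΩ h𝒲 ha u u hf hf)
  rw [Real.mul_rpow ha.pos.le hε.le] at h1
  have h4 : a₁ * ε * ‖D u‖ ^ 2 ≤ ε * (matrixForm ha (D u) (D u)).re := by
    calc a₁ * ε * ‖D u‖ ^ 2 = ε * (a₁ * ‖D u‖ ^ 2) := by ring
      _ ≤ _ := by gcongr
  calc ‖mulOp Ω (vPart V) ⟨J u, hdom (hK.mem u)⟩‖ ^ 2 ≤
        a₁ * ε * ‖D u‖ ^ 2 + M * (a₁ ^ (-β) * ε ^ (-β)) * ‖J u‖ ^ 2 := h1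
    _ ≤ ε * (matrixForm ha (D u) (D u)).re + M * (a₁ ^ (-β) * ε ^ (-β)) * ‖J u‖ ^ 2 := by gcongr
    _ = ε * ((ellipticForm h𝒲 ha).form ⟨J u, hf⟩ ⟨J u, hf⟩).re +
        M * a₁ ^ (-β) * ε ^ (-β) * ‖J u‖ ^ 2 := by
      rw [h3]
      ring

variable [CompleteSpace K] {B : L2vec Ω →L[ℂ] L2vec Ω} {T U : K →L[ℂ] L2 Ω}

theorem formSum_isRepresentedBy (hΩ : IsOpen Ω) (h𝒲 : IsFormSpace Ω 𝒲)
    (ha : IsUniformlyElliptic Ω a a₁ a₂) (hV : AEMeasurable V (volume.restrict Ω))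
    (hdom : 𝒲 ≤ (mulOp Ω (vPart V)).domain) (hB : ∀ F G, matrixForm ha F G = ⟪F, B G⟫_ℂ)
    (hT : ∀ u, T u = mulOp Ω (vPart V) ⟨J u, hdom (hK.mem u)⟩)
    (hU : ∀ u, U u = mulOp Ω (uPart V) ⟨J u, vPart_domain_le hV (hdom (hK.mem u))⟩) :
    ((ellipticForm h𝒲 ha).sum (potentialForm hV)).IsRepresentedBy J
      (ContinuousLinearMap.adjoint D ∘L B ∘L D + ContinuousLinearMap.adjoint T ∘L U) where
  injective := hK.injective hΩ
  denseRange := hK.denseRange hΩ h𝒲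
  range_eq := hK.range_eq.trans (inf_eq_left.2 hdom).symm
  form_eq w u hw hu := by
    have h1 : (ellipticForm h𝒲 ha).form ⟨J w, hK.mem w⟩ ⟨J u, hK.mem u⟩ =
        ⟪w, (ContinuousLinearMap.adjoint D ∘L B ∘L D) u⟫_ℂ := by
      rw [inner_adjoint_comp_comp, ← hB]
      exact hK.ellipticForm_apply hΩ h𝒲 ha w u (hK.mem w) (hK.mem u)
    have h2 : (potentialForm hV).form ⟨J w, hdom (hK.mem w)⟩ ⟨J u, hdom (hK.mem u)⟩ =
        ⟪T w, U u⟫_ℂ := congrArg₂ (inner ℂ) (hT w).symm (hU u).symm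
    exact (congrArg₂ (· + ·) h1 h2).trans (inner_add_adjoint_comp _ T U w u).symm

end IsSobolevEmbedding

/-- A form perturbation with polynomial form bounds preserves quasi-coercivity. -/
theorem HasPolynomialFormBound.quasiCoercive_add {H K G : Type*}
    [NormedAddCommGroup H] [InnerProductSpace ℂ H]
    [NormedAddCommGroup K] [InnerProductSpace ℂ K] [CompleteSpace K]
    [NormedAddCommGroup G] [InnerProductSpace ℂ G] [CompleteSpace G]
    {J : K →L[ℂ] H} {A₀ : K →L[ℂ] K} {T U : K →L[ℂ] G} {c r M β ε₀ : ℝ}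
    (hT : HasPolynomialFormBound J T M β ε₀) (hM : 0 < M) (hε₀ : 0 < ε₀)
    (hTU : ∀ u, ‖U u‖ = ‖T u‖) (hc : 0 < c) (h₀ : QuasiCoercive J A₀ c r) :
    ∃ c' r', 0 < c' ∧ QuasiCoercive J A₀ c' r' ∧
      QuasiCoercive J (A₀ + ContinuousLinearMap.adjoint T ∘L U) c' r' := by
  -- The first entry lets half of the coercivity absorb the perturbation, and the second keeps `ε`
  -- admissible. The `‖J u‖²` term is absorbed by enlarging the shift `r`.
  set ε := min (c / 2) (ε₀ / 2) with hε
  have hε0 : 0 < ε := by positivity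
  have hεc : ε ≤ c / 2 := min_le_left _ _
  have hεε₀ : ε < ε₀ := (min_le_right _ _).trans_lt (half_lt_self hε₀)
  have hMε : 0 ≤ M * ε ^ (-β) := by positivity
  refine ⟨c / 2, r + M * ε ^ (-β), half_pos hc, fun u => ?_, fun u => ?_⟩
  · have h1 := h₀ u
    have h2 : 0 ≤ c / 2 * ‖u‖ ^ 2 := by positivity
    have h3 : 0 ≤ M * ε ^ (-β) * ‖J u‖ ^ 2 := by positivity
    linarith
  · have h1 := h₀ u
    have h2 := hT ε hε0 hεε₀ u
    have h4 : |(⟪T u, U u⟫_ℂ).re| ≤ ‖T u‖ ^ 2 := by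
      refine (Complex.abs_re_le_norm _).trans ((norm_inner_le_norm _ _).trans (le_of_eq ?_))
      rw [hTU, sq]
    have h5 := (abs_le.1 h4).1
    have h6 : ε * ‖u‖ ^ 2 ≤ c / 2 * ‖u‖ ^ 2 := by gcongr
    rw [inner_add_adjoint_comp, Complex.add_re]
    linarith

end FormSum

/-! ### Assembly of the theorem, for an arbitrary Hilbert space model of 𝒲. -/

set_option maxHeartbeats 1000000 in
theorem IsSobolevEmbedding.infinitesimallyBounded_and_sqrtOp_domain {n : ℕ}
    {Ω : Set (EuclideanSpace ℝ (Fin n))} (hΩ : IsOpen Ω)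
    {a : EuclideanSpace ℝ (Fin n) → Matrix (Fin n) (Fin n) ℂ} {a₁ a₂ : ℝ}
    (ha : IsUniformlyElliptic Ω a a₁ a₂) {𝒲 : Submodule ℂ (L2 Ω)} (h𝒲 : IsFormSpace Ω 𝒲)
    {K : Type*} [NormedAddCommGroup K] [InnerProductSpace ℂ K] [CompleteSpace K]
    {J : K →L[ℂ] L2 Ω} {D : K →L[ℂ] L2vec Ω} (hK : IsSobolevEmbedding 𝒲 J D)
    {V : EuclideanSpace ℝ (Fin n) → ℂ} (hV : AEMeasurable V (volume.restrict Ω))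
    (hdom : 𝒲 ≤ (mulOp Ω (vPart V)).domain)
    (hL : (sqrtOp (ellipticOp h𝒲 ha)).domain = 𝒲)
    (hLadj : (sqrtOp ((ellipticOp h𝒲 ha)†)).domain = 𝒲)
    {M β ε₀ : ℝ} (hM : 0 < M) (hβ : 0 < β) (hε₀ : 0 < ε₀)
    (hbound : ∀ ε : ℝ, 0 < ε → ε < ε₀ →
      ∀ (f : L2 Ω) (hf : f ∈ 𝒲) (hfΔ : f ∈ (sqrtOp (negLaplacian h𝒲)).domain),
        ‖mulOp Ω (vPart V) ⟨f, hdom hf⟩‖ ^ 2 ≤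
          ε * ‖sqrtOp (negLaplacian h𝒲) ⟨f, hfΔ⟩‖ ^ 2 + M * ε ^ (-β) * ‖f‖ ^ 2) :
    ((potentialForm hV).IsInfinitesimallyBounded (ellipticForm h𝒲 ha) ∧
      ∀ ε : ℝ, 0 < ε → ε < a₁⁻¹ * ε₀ → ∀ (f : L2 Ω) (hf : f ∈ 𝒲),
        ‖mulOp Ω (vPart V) ⟨f, hdom hf⟩‖ ^ 2 ≤
          ε * ((ellipticForm h𝒲 ha).form ⟨f, hf⟩ ⟨f, hf⟩).re +
            M * a₁ ^ (-β) * ε ^ (-β) * ‖f‖ ^ 2) ∧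
    (IsMSectorial (formSumOp h𝒲 ha hV) ∧
      ∀ t : ℝ, IsMAccretive (addScalar (formSumOp h𝒲 ha hV) t) →
        (sqrtOp (addScalar (formSumOp h𝒲 ha hV) t)).domain = 𝒲 ∧
          (sqrtOp (addScalar ((formSumOp h𝒲 ha hV)†) t)).domain = 𝒲) := by
  have hb : ∀ ε : ℝ, 0 < ε → ε < ε₀ → ∀ u : K,
      ‖mulOp Ω (vPart V) ⟨J u, hdom (hK.mem u)⟩‖ ^ 2 ≤
        ε * ‖D u‖ ^ 2 + M * ε ^ (-β) * ‖J u‖ ^ 2 :=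
    fun ε hε hεε₀ u => hK.polynomialFormBound hΩ h𝒲 hdom hbound hε hεε₀ u
  have hb' : ∀ ε : ℝ, 0 < ε → ε < ε₀ → ∀ u : K,
      ‖mulOp Ω (vPart V) ⟨J u, hdom (hK.mem u)⟩‖ ^ 2 ≤
        ε * ‖u‖ ^ 2 + M * ε ^ (-β) * ‖J u‖ ^ 2 := by
    intro ε hε hεε₀ u
    refine (hb ε hε hεε₀ u).trans ?_
    gcongr
    exact hK.norm_grad_le u
  have hrel : ∀ ε : ℝ, 0 < ε → ε < a₁⁻¹ * ε₀ → ∀ (f : L2 Ω) (hf : f ∈ 𝒲),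
      ‖mulOp Ω (vPart V) ⟨f, hdom hf⟩‖ ^ 2 ≤
        ε * ((ellipticForm h𝒲 ha).form ⟨f, hf⟩ ⟨f, hf⟩).re +
          M * a₁ ^ (-β) * ε ^ (-β) * ‖f‖ ^ 2 :=
    fun ε hε hεε₀ f hf => hK.potential_le_ellipticForm hΩ h𝒲 ha hdom hb hε hεε₀ f hf
  refine ⟨⟨⟨hdom, fun α hα => ?_⟩, hrel⟩, ?_⟩
  · have ha₁ := ha.pos
    -- A large `α` may lie outside the admissible range; a smaller `ε` gives a stronger bound.
    set ε := min α (a₁⁻¹ * ε₀ / 2) with hε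
    have hε0 : 0 < ε := by positivity
    refine ⟨M * a₁ ^ (-β) * ε ^ (-β), by positivity, fun f => ?_⟩
    have h1 := hrel ε hε0 ((min_le_right _ _).trans_lt (half_lt_self (by positivity))) f f.2
    refine (norm_potentialForm_le hV _).trans (h1.trans ?_)
    gcongr ?_ + _
    refine (mul_le_mul_of_nonneg_left (Complex.re_le_norm _) hε0.le).trans ?_
    gcongr
    exact min_le_left _ _
  · obtain ⟨B, hB⟩ := exists_matrixForm_eq_inner ha
    have hnorm : ∀ u, ‖mulOp Ω (uPart V) ⟨J u, vPart_domain_le hV (hdom (hK.mem u))⟩‖ =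
        ‖mulOp Ω (vPart V) ⟨J u, hdom (hK.mem u)⟩‖ := fun u => norm_mulOp_uPart _ _
    -- The form bound at the single value `ε = ε₀/2`, with `‖J u‖ ≤ ‖u‖`, already makes
    -- multiplication by `v` bounded on the form domain.
    have hC : ∀ u, ‖mulOp Ω (vPart V) ⟨J u, hdom (hK.mem u)⟩‖ ≤
        √(ε₀ / 2 + M * (ε₀ / 2) ^ (-β)) * ‖u‖ := by
      intro u
      refine (abs_le_of_sq_le_sq' ?_ (by positivity)).2
      rw [mul_pow, Real.sq_sqrt (by positivity), add_mul]
      refine (hb' (ε₀ / 2) (half_pos hε₀) (half_lt_self hε₀) u).trans ?_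
      gcongr
      exact hK.norm_le u
    have hTex : ∃ T : K →L[ℂ] L2 Ω, ∀ u, T u = mulOp Ω (vPart V) ⟨J u, hdom (hK.mem u)⟩ :=
      exists_clm_eq_mulOp (J := J) (m := vPart V) (fun u => hdom (hK.mem u)) hC
    obtain ⟨T, hT⟩ := hTex
    have hUex : ∃ U : K →L[ℂ] L2 Ω, ∀ u, U u =
        mulOp Ω (uPart V) ⟨J u, vPart_domain_le hV (hdom (hK.mem u))⟩ :=
      exists_clm_eq_mulOp (J := J) (m := uPart V)
        (fun u => vPart_domain_le hV (hdom (hK.mem u))) (fun u => (hnorm u).trans_le (hC u))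
    obtain ⟨U, hU⟩ := hUex
    have hTU : ∀ u, ‖U u‖ = ‖T u‖ := fun u =>
      (congrArg norm (hU u)).trans ((hnorm u).trans (congrArg norm (hT u)).symm)
    have hTb : HasPolynomialFormBound J T M β ε₀ := fun ε hε hεε₀ u => by
      rw [hT]
      exact hb' ε hε hεε₀ u
    have hUb : HasPolynomialFormBound J U M β ε₀ := fun ε hε hεε₀ u => by
      rw [hTU]
      exact hTb ε hε hεε₀ u
    have hq₀ := hK.ellipticForm_isRepresentedBy hΩ h𝒲 ha hB
    have hq := hK.formSum_isRepresentedBy hΩ h𝒲 ha hV hdom hB hT hU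
    obtain ⟨c, hc, hc1⟩ := hK.quasiCoercive ha hB one_pos
    obtain ⟨c', r', hc', h₀, h⟩ := hTb.quasiCoercive_add hM hε₀ hTU hc hc1
    refine ⟨hq.isMSectorial hc' h, fun t ht => ?_⟩
    have hmain := hq₀.sqrtOp_domain_of_perturbation hq hM hβ hε₀ hUb hTb rfl hK.norm_le hc' h₀ h
      (fun r hr => hK.quasiCoercive ha hB hr) (hL.trans hK.range_eq.symm)
      (hLadj.trans hK.range_eq.symm) ht
    rw [hK.range_eq] at hmain
    exact hmain

theorem theorem3p6 (n : ℕ) (hn : 1 ≤ n)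
    (Ω : Set (EuclideanSpace ℝ (Fin n))) (hΩ : IsOpen Ω) (hΩne : Ω.Nonempty)
    (hΩ1 : n = 1 → IsPreconnected Ω)
    (a : EuclideanSpace ℝ (Fin n) → Matrix (Fin n) (Fin n) ℂ) (a₁ a₂ : ℝ)
    (ha : IsUniformlyElliptic Ω a a₁ a₂)
    (𝒲 : Submodule ℂ (L2 Ω)) (h𝒲 : IsFormSpace Ω 𝒲)
    (V : EuclideanSpace ℝ (Fin n) → ℂ) (hV : AEMeasurable V (volume.restrict Ω))
    (hdom : 𝒲 ≤ (mulOp Ω (vPart V)).domain)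
    (hL : (sqrtOp (ellipticOp h𝒲 ha)).domain = 𝒲)
    (hLadj : (sqrtOp ((ellipticOp h𝒲 ha)†)).domain = 𝒲)
    (M β ε₀ : ℝ) (hM : 0 < M) (hβ : 0 < β) (hε₀ : 0 < ε₀)
    (hbound : ∀ ε : ℝ, 0 < ε → ε < ε₀ →
      ∀ (f : L2 Ω) (hf : f ∈ 𝒲) (hfΔ : f ∈ (sqrtOp (negLaplacian h𝒲)).domain),
        ‖mulOp Ω (vPart V) ⟨f, hdom hf⟩‖ ^ 2 ≤
          ε * ‖sqrtOp (negLaplacian h𝒲) ⟨f, hfΔ⟩‖ ^ 2 + M * ε ^ (-β) * ‖f‖ ^ 2) :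
    ((potentialForm hV).IsInfinitesimallyBounded (ellipticForm h𝒲 ha) ∧
      ∀ ε : ℝ, 0 < ε → ε < a₁⁻¹ * ε₀ → ∀ (f : L2 Ω) (hf : f ∈ 𝒲),
        ‖mulOp Ω (vPart V) ⟨f, hdom hf⟩‖ ^ 2 ≤
          ε * ((ellipticForm h𝒲 ha).form ⟨f, hf⟩ ⟨f, hf⟩).re +
            M * a₁ ^ (-β) * ε ^ (-β) * ‖f‖ ^ 2) ∧
    (IsMSectorial (formSumOp h𝒲 ha hV) ∧
      ∀ t : ℝ, IsMAccretive (addScalar (formSumOp h𝒲 ha hV) t) →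
        (sqrtOp (addScalar (formSumOp h𝒲 ha hV) t)).domain =
            (sqrtOp (addScalar ((formSumOp h𝒲 ha hV)†) t)).domain ∧
          (sqrtOp (addScalar ((formSumOp h𝒲 ha hV)†) t)).domain =
            (sqrtOp (ellipticOp h𝒲 ha)).domain ∧
          (sqrtOp (ellipticOp h𝒲 ha)).domain = (sqrtOp ((ellipticOp h𝒲 ha)†)).domain ∧
          (sqrtOp ((ellipticOp h𝒲 ha)†)).domain = 𝒲) := by
  -- The concrete Hilbert space is the set of pairs `(f, ∇f)` with `f` in 𝒲; its completeness is the
  -- closedness of 𝒲 in `W^{1,2}(Ω)`.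
  have : CompleteSpace (gradGraph 𝒲) := h𝒲.isClosed_gradGraph.completeSpace_coe
  obtain ⟨hi, hsec, ht⟩ := h𝒲.isSobolevEmbedding.infinitesimallyBounded_and_sqrtOp_domain hΩ ha h𝒲
    hV hdom hL hLadj hM hβ hε₀ hbound
  refine ⟨hi, hsec, fun t hacc => ?_⟩
  obtain ⟨h1, h2⟩ := ht t hacc
  exact ⟨h1.trans h2.symm, h2.trans hL.symm, hL.trans hLadj.symm, hLadj⟩
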